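/- Let $G=(V,E)$ be a finite simple undirected graph with $V\neq\emptyset$ and let $\underline h=(h_i)_{i\in V}$ be real numbers with $h_i\ge 0$. For $\beta\ge 0$ consider the asynchronous Glauber (heat bath, logit) dynamics on $\{+1,-1\}^V$: each vertex $i$ carries an independent rate-$1$ Poisson clock, and when it rings in the configuration $\underline x$ the value at $i$ is replaced by $y\in\{+1,-1\}$ with probability $\big(1+e^{-2\beta K_i(\underline x)y}\big)^{-1}$, where $K_i(\underline x)=h_i+\sum_{j\sim i}x_j$. (This dynamics is reversible with respect to $\mu_\beta(\underline x)\propto e^{-\beta H(\underline x)}$, $H(\underline x)=-\sum_{(i,j)\in E}x_ix_j-\sum_i h_ix_i$.) Let $T_+$ be the hitting time of the all-$(+1)$ configuration, and let $$\tau_+(G;\underline h)=\sup_{\underline x}\inf\{t\ge 0:\ \mathbb P_\beta^{\underline x}\{T_+\ge t\}\le e^{-1}\}.$$ For a finite graph $F$ with vertex set $U\ne\emptyset$ and real fields $\underline k=(k_i)_{i\in U}$, put $E_{F,\underline k}(S)=\mathrm{cut}_F(S,U\setminus S)-\sum_{i\in S}k_i$ for $S\subseteq U$, where $\mathrm{cut}_F$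 counts the edges of $F$ between the two sets. The tilted cutwidth of $F$ is $$\Gamma(F;\underline k)=\min\ \max_{0\le t\le |U|}E_{F,\underline k}(S_t),$$ the minimum being over all linear orderings $i(1),\dots,i(|U|)$ of $U$, with $S_t=\{i(1),\dots,i(t)\}$. The tilted cut of $F$ is $$\Delta(F;\underline k)=\max_{\Omega}\ \min_{(S_1,S_2)\in\partial\Omega}\ \max_{a=1,2}E_{F,\underline k}(S_a),$$ the maximum being over all families $\Omega\subseteq 2^U$ that are closed under taking subsets and satisfy $\emptyset\in\Omega$, $U\notin\Omega$, where $\partial\Omega$ is the set of pairs $(S,S\cup\{i\})$ with $i\in U$, $S\in\Omega$, $S\cup\{i\}\notin\Omega$. For an induced subgraph $F$ of $G$ on a nonempty vertex set let $h^F_i=h_i+|\{j\in V\setminus V(F):\ j\sim i\}|$ for $i\in V(F)$. Then $$\tau_+(G;\underline h)=\exp\{2\beta\,\Gamma_*(G;\underline h)+o(\beta)\}\qquad(\beta\to\infty),$$ where $$\Gamma_*(G;\underline h)=\max_{F}\Gamma(F;\underline h^F)=\max_{F}\Delta(F;\underline h^F),$$ the maxima being over all induced subgraphs $F$ of $G$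 on a nonempty set of vertices. -/

import Mathlib

open MeasureTheory Filter
open scoped ENNReal NNReal

noncomputable section

namespace Glauber

section Combinatorics

open scoped Classical

variable {V : Type*} [Fintype V]

/-- The tilted cut function `cut(S, V \ S) - |S|_h`, where `cut(S, V \ S)` is the number of edges
between `S` and its complement and `|S|_h` is the sum of `h i` over `i ∈ S`. -/
def tiltedEnergy (G : SimpleGraph V) (h : V → ℝ) (S : Finset V) : ℝ :=
  ((G.interedges S Sᶜ).card : ℝ) - ∑ i ∈ S, h i

/-- The set `S_t` of the first `t` vertices in a linear ordering of the vertices. -/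
def initialSet (σ : Fin (Fintype.card V) ≃ V) (t : ℕ) : Finset V :=
  Finset.univ.filter fun v => (σ.symm v : ℕ) < t

/-- The tilted cutwidth: the minimum over linear orderings of the vertices of the maximum over
`0 ≤ t ≤ n` of `cut(S_t, V \ S_t) - |S_t|_h`. -/
def tiltedCutwidth (G : SimpleGraph V) (h : V → ℝ) : ℝ :=
  ⨅ σ : Fin (Fintype.card V) ≃ V, ⨆ t : Fin (Fintype.card V + 1),
    tiltedEnergy G h (initialSet σ t)

/-- The monotone (downward closed) families `Ω` of sets of vertices that contain the empty set and
do not contain the set of all vertices. -/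
def IsMonotoneFamily (Ω : Set (Finset V)) : Prop :=
  (∅ : Finset V) ∈ Ω ∧ (Finset.univ : Finset V) ∉ Ω ∧ ∀ S ∈ Ω, ∀ S' ⊆ S, S' ∈ Ω

/-- The boundary of `Ω`: the pairs `(S, S ∪ {i})` with `S ∈ Ω` and `S ∪ {i} ∉ Ω`. -/
def boundary (Ω : Set (Finset V)) : Set (Finset V × Finset V) :=
  {p | p.1 ∈ Ω ∧ p.2 ∉ Ω ∧ ∃ i : V, p.2 = insert i p.1}

/-- The tilted cut: the maximum over monotone families `Ω` of the minimum over boundary pairs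
`(S₁, S₂)` of the larger of the two values of `cut(S_i, V \ S_i) - |S_i|_h`. -/
def tiltedCut (G : SimpleGraph V) (h : V → ℝ) : ℝ :=
  ⨆ Ω : {Ω : Set (Finset V) // IsMonotoneFamily Ω}, ⨅ p : boundary Ω.1,
    max (tiltedEnergy G h p.1.1) (tiltedEnergy G h p.1.2)

/-- The modified field on `F`: `h^F_i` is `h i` plus the number of neighbours of `i` outside
`F`. -/
def inducedField (G : SimpleGraph V) (h : V → ℝ) (F : Set V) (i : F) : ℝ :=
  h i + ((Finset.univ.filter fun j : V => G.Adj i j ∧ j ∉ F).card : ℝ)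

/-- The maximum, over the induced subgraphs on a nonempty set `F` of vertices, of the tilted
cutwidth with the modified field. -/
def maxTiltedCutwidth (G : SimpleGraph V) (h : V → ℝ) : ℝ :=
  ⨆ F : {F : Set V // F.Nonempty}, tiltedCutwidth (G.induce F.1) (inducedField G h F.1)

/-- The maximum, over the induced subgraphs on a nonempty set `F` of vertices, of the tilted
cut with the modified field. -/
def maxTiltedCut (G : SimpleGraph V) (h : V → ℝ) : ℝ :=
  ⨆ F : {F : Set V // F.Nonempty}, tiltedCut (G.induce F.1) (inducedField G h F.1)

end Combinatorics

section Dynamics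

open scoped Classical

variable {V : Type*} [Fintype V]

/-- The local field `K_i(x) = h_i + ∑_{j ∼ i} x_j` of a configuration `x ∈ {+1, -1}^V`. -/
def localField (G : SimpleGraph V) (h : V → ℝ) (x : V → ℤˣ) (i : V) : ℝ :=
  h i + ∑ j ∈ G.neighborFinset i, ((x j : ℤ) : ℝ)

/-- The heat bath (logit) probability `1 / (1 + exp (-2 β K_i(x) y))` that vertex `i` takes the
value `y` when it is updated in the configuration `x`. -/
def heatBath (G : SimpleGraph V) (h : V → ℝ) (β : ℝ) (x : V → ℤˣ) (i : V) (y : ℤˣ) : ℝ :=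
  (1 + Real.exp (-2 * β * localField G h x i * ((y : ℤ) : ℝ)))⁻¹

/-- The update of vertex `i` driven by a uniform random number `u`: the new value is `+1` when
`u` is at most the heat bath probability of `+1`, and `-1` otherwise. -/
def update (G : SimpleGraph V) (h : V → ℝ) (β : ℝ) (x : V → ℤˣ) (i : V) (u : unitInterval) :
    V → ℤˣ :=
  Function.update x i (if (u : ℝ) ≤ heatBath G h β x i 1 then 1 else -1)

/-- One ring of the clocks: the waiting time since the previous ring (of whichever clock), the
vertex whose clock rings, and the random number used in the update. -/
abbrev Ring (V : Type*) := ℝ × V × unitInterval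

/-- The law of a ring. The superposition of independent rate one Poisson clocks, one at each
vertex, is a Poisson process of rate `|V|` whose points carry independent uniform vertices. -/
def ringLaw (V : Type*) [Fintype V] [MeasurableSpace V] : Measure (Ring V) :=
  (ProbabilityTheory.expMeasure (Fintype.card V)).prod
    ((ProbabilityTheory.uniformOn (Set.univ : Set V)).prod volume)

instance isProbabilityMeasure_ringLaw (V : Type*) [Fintype V] [Nonempty V] [MeasurableSpace V]
    [MeasurableSingletonClass V] : IsProbabilityMeasure (ringLaw V) := by
  have h1 : IsProbabilityMeasure (ProbabilityTheory.expMeasure (Fintype.card V)) :=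
    ProbabilityTheory.isProbabilityMeasure_expMeasure (by exact_mod_cast Fintype.card_pos)
  have h2 : IsProbabilityMeasure (ProbabilityTheory.uniformOn (Set.univ : Set V)) :=
    ProbabilityTheory.isProbabilityMeasure_uniformOn Set.finite_univ Set.univ_nonempty
  unfold ringLaw
  infer_instance

/-- The law of the sequence of rings: independent rings with law `ringLaw`. -/
def clockLaw (V : Type*) [Fintype V] [MeasurableSpace V] : Measure (ℕ → Ring V) :=
  Measure.infinitePi fun _ => ringLaw V

/-- The time of the `m`-th ring (with `0` for `m = 0`). -/
def ringTime (ω : ℕ → Ring V) (m : ℕ) : ℝ := ∑ k ∈ Finset.range m, (ω k).1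

/-- The configuration after `m` rings, starting from `x`. -/
def afterRings (G : SimpleGraph V) (h : V → ℝ) (β : ℝ) (x : V → ℤˣ) (ω : ℕ → Ring V) :
    ℕ → V → ℤˣ
  | 0 => x
  | m + 1 => update G h β (afterRings G h β x ω m) (ω m).2.1 (ω m).2.2

/-- The number of rings up to (and including) time `t`. -/
def ringCount (ω : ℕ → Ring V) (t : ℝ) : ℕ := {m : ℕ | ringTime ω (m + 1) ≤ t}.ncard

/-- The configuration at time `t` of the asynchronous Glauber dynamics started from `x`. -/
def process (G : SimpleGraph V) (h : V → ℝ) (β : ℝ) (x : V → ℤˣ) (ω : ℕ → Ring V) (t : ℝ) :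
    V → ℤˣ :=
  afterRings G h β x ω (ringCount ω t)

/-- The hitting time `T_+` of the all-`(+1)` configuration (infinite if it is never hit). -/
def hittingTime (G : SimpleGraph V) (h : V → ℝ) (β : ℝ) (x : V → ℤˣ) (ω : ℕ → Ring V) : ℝ≥0∞ :=
  ⨅ (t : ℝ≥0) (_ : process G h β x ω t = fun _ => 1), (t : ℝ≥0∞)

/-- The probability that `T_+ ≥ t` for the dynamics started from `x`. -/
def probHittingGE (G : SimpleGraph V) (h : V → ℝ) (β : ℝ) (x : V → ℤˣ) (t : ℝ≥0) : ℝ≥0∞ :=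
  letI : MeasurableSpace V := ⊤
  clockLaw V {ω | (t : ℝ≥0∞) ≤ hittingTime G h β x ω}

/-- The typical hitting time `τ_+`: the supremum over initial configurations `x` of the infimum of
the times `t ≥ 0` for which the probability of `T_+ ≥ t` is at most `1 / e`. -/
def typicalHittingTime (G : SimpleGraph V) (h : V → ℝ) (β : ℝ) : ℝ≥0∞ :=
  ⨆ x : V → ℤˣ, ⨅ (t : ℝ≥0)
    (_ : probHittingGE G h β x t ≤ ENNReal.ofReal (Real.exp (-1))), (t : ℝ≥0∞)

end Dynamics

end Glauber

end

noncomputable section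

namespace Glauber

/-! ### Submodularity of the tilted cut function -/

section Submodular

open scoped Classical

variable {V : Type*} [Fintype V]

/-! Identify a configuration with its set `S` of plus vertices. Up to a constant, `H` is twice the
tilted energy `E`, so the dynamics is a reversible heat bath on sets with weight `exp (-2βE)`. It is
attractive because `E` is submodular.

Duality on each induced subgraph is proved in the manner of Bienstock and Seymour. If the tilted cut
is below `γ`, the sets reachable by "crusades" (sequences of sets that gain at most one vertex per
step and lose arbitrarily many, with energies below `γ`) cannot form an obstructing monotone family,
so some crusade reaches the full set. A minimal crusade is increasing by submodularity
(`IsCrusade.exists_monotone`), hence gives an ordering. Freezing the vertices outside `F` at `+1`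
turns `h` into the induced field and shifts the energy by a constant (`tiltedEnergy_induce`). Thus
the two maxima describe climbs from an arbitrary set and barriers above a suitable set.

Upper bound: from every `y`, an ordering of the complement climbs to the full set with energy excess
at most `Γ_*`. A Dirichlet form estimate along this climb bounds the truncated Green function at `y`
by a constant times `exp (2βΓ_*)`. Summing over `y` bounds the truncated mean hitting time, and then
Markov's inequality applies (`mul_one_sub_hitProb_le`).

Lower bound: take `A` to be the complement of an optimal `F`, with its optimal monotone family, and
start from `A`. Forcing the vertices of `A` to stay plus only speeds up the hitting, by
attractiveness. The forced chain is reversible on the sets containing `A`, and its equilibrium flow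
through the boundary of the family is at most a constant times `exp (-2βΓ_*)` relative to the weight
of `A` (`hitProb_le`).

Tail bounds for the ring times transfer both estimates to continuous time. The bounds on `τ_+` then
differ only by constant factors, which the `o(β)` term absorbs. -/

theorem tiltedEnergy_eq_sum (G : SimpleGraph V) (h : V → ℝ) (S : Finset V) :
    tiltedEnergy G h S =
      (∑ p : V × V, if p.1 ∈ S ∧ p.2 ∉ S ∧ G.Adj p.1 p.2 then (1 : ℝ) else 0) -
        ∑ i, if i ∈ S then h i else 0 := by
  unfold tiltedEnergy
  congr 1
  · rw [Finset.sum_boole]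
    congr 2
    ext p
    simp only [SimpleGraph.mem_interedges_iff, Finset.mem_compl, Finset.mem_filter,
      Finset.mem_univ, true_and]
  · rw [← Finset.sum_filter]
    congr 1
    ext i
    simp

@[simp]
theorem tiltedEnergy_empty (G : SimpleGraph V) (h : V → ℝ) : tiltedEnergy G h ∅ = 0 := by
  simp [tiltedEnergy_eq_sum]

/-- The field term is modular. The cut term is submodular one ordered pair of vertices at a time,
which is a finite check of memberships. -/
theorem tiltedEnergy_submodular (G : SimpleGraph V) (h : V → ℝ) (S T : Finset V) :
    tiltedEnergy G h (S ∪ T) + tiltedEnergy G h (S ∩ T) ≤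
      tiltedEnergy G h S + tiltedEnergy G h T := by
  have h1 : (∑ i, if i ∈ S ∪ T then h i else 0) + (∑ i, if i ∈ S ∩ T then h i else 0) =
      (∑ i, if i ∈ S then h i else 0) + ∑ i, if i ∈ T then h i else 0 := by
    rw [← Finset.sum_add_distrib, ← Finset.sum_add_distrib]
    refine Finset.sum_congr rfl fun i _ => ?_
    by_cases a : i ∈ S <;> by_cases b : i ∈ T <;> simp [a, b]
  have h2 : (∑ p : V × V, if p.1 ∈ S ∪ T ∧ p.2 ∉ S ∪ T ∧ G.Adj p.1 p.2 then (1 : ℝ) else 0) +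
        (∑ p : V × V, if p.1 ∈ S ∩ T ∧ p.2 ∉ S ∩ T ∧ G.Adj p.1 p.2 then (1 : ℝ) else 0) ≤
      (∑ p : V × V, if p.1 ∈ S ∧ p.2 ∉ S ∧ G.Adj p.1 p.2 then (1 : ℝ) else 0) +
        ∑ p : V × V, if p.1 ∈ T ∧ p.2 ∉ T ∧ G.Adj p.1 p.2 then (1 : ℝ) else 0 := by
    rw [← Finset.sum_add_distrib, ← Finset.sum_add_distrib]
    refine Finset.sum_le_sum fun p _ => ?_
    by_cases a : p.1 ∈ S <;> by_cases b : p.1 ∈ T <;> by_cases c : p.2 ∈ S <;>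
      by_cases d : p.2 ∈ T <;> by_cases e : G.Adj p.1 p.2 <;> simp [a, b, c, d, e]
  simp only [tiltedEnergy_eq_sum]
  linarith

end Submodular

/-! ### Increasing chains of sets and vertex orderings -/

section Chains

open scoped Classical

variable {V : Type*}

/-- `Climbs P S T`: one can pass from `S` to `T` by adding vertices one at a time, through sets
that all satisfy `P`. -/
inductive Climbs (P : Finset V → Prop) (S : Finset V) : Finset V → Prop
  | refl : P S → Climbs P S S
  | step {T : Finset V} (i : V) : Climbs P S T → P (insert i T) → Climbs P S (insert i T)

/-- The chain may stall; stalled steps are dropped, so no strictness is needed. -/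
theorem Climbs.of_subset_chain {P : Finset V → Prop} {X : ℕ → Finset V} {n : ℕ}
    (hP : ∀ j ≤ n, P (X j)) (hmono : ∀ j < n, X j ⊆ X (j + 1))
    (hcard : ∀ j < n, (X (j + 1) \ X j).card ≤ 1) : Climbs P (X 0) (X n) := by
  induction n with
  | zero => exact .refl (hP 0 le_rfl)
  | succ n ih =>
    have h0 := ih (fun j hj => hP j (by omega)) (fun j hj => hmono j (by omega))
      (fun j hj => hcard j (by omega))
    have hs := hmono n (by omega)
    rcases Nat.le_one_iff_eq_zero_or_eq_one.1 (hcard n (by omega)) with hc | hc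
    · have : X (n + 1) = X n := by
        refine Finset.Subset.antisymm ?_ hs
        rwa [Finset.card_eq_zero, Finset.sdiff_eq_empty_iff_subset] at hc
      rwa [this]
    · obtain ⟨i, hi⟩ := Finset.card_eq_one.1 hc
      have : X (n + 1) = insert i (X n) := by
        rw [← Finset.union_sdiff_of_subset hs, hi, Finset.union_comm]
        rfl
      rw [this]
      exact h0.step i (this ▸ hP _ le_rfl)

/-- A climb from the empty set visits the prefixes of a list. -/
theorem Climbs.exists_list {P : Finset V → Prop} {T : Finset V} (hT : Climbs P ∅ T) :
    ∃ l : List V, l.Nodup ∧ l.toFinset = T ∧ ∀ t, P (l.take t).toFinset := by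
  induction hT with
  | refl h => exact ⟨[], by simp, by simp, by simpa using h⟩
  | @step T i _ hi ih =>
    obtain ⟨l, hl, hlT, hP⟩ := ih
    by_cases hm : i ∈ T
    · exact ⟨l, hl, by rw [hlT, Finset.insert_eq_of_mem hm], hP⟩
    · refine ⟨l ++ [i], ?_, ?_, fun t => ?_⟩
      · rw [List.nodup_append]
        refine ⟨hl, by simp, ?_⟩
        intro a ha b hb hab
        simp only [List.mem_singleton] at hb
        subst hab hb
        exact hm (hlT ▸ List.mem_toFinset.2 ha)
      · ext a
        simp [← hlT]
      · rcases le_or_gt t l.length with ht | ht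
        · rw [List.take_append_of_le_length ht]
          exact hP t
        · rw [List.take_of_length_le (by simp; omega)]
          convert hi using 1
          ext a
          simp [← hlT]

theorem Climbs.exists_ordering [Fintype V] {P : Finset V → Prop} (hT : Climbs P ∅ Finset.univ) :
    ∃ σ : Fin (Fintype.card V) ≃ V, ∀ t, P (initialSet σ t) := by
  obtain ⟨l, hl, hlT, hP⟩ := hT.exists_list
  have hmem : ∀ a, a ∈ l := fun a => by
    rw [← List.mem_toFinset, hlT]; exact Finset.mem_univ a
  have hlen : l.length = Fintype.card V := by
    rw [← List.toFinset_card_of_nodup hl, hlT, Finset.card_univ]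
  refine ⟨(finCongr hlen.symm).trans (hl.getEquivOfForallMemList l hmem), fun t => ?_⟩
  convert hP t using 1
  ext a
  simp only [initialSet, Finset.mem_filter, Finset.mem_univ, true_and, List.mem_toFinset,
    Equiv.symm_trans_apply, finCongr_symm, finCongr_apply, Fin.val_cast]
  rw [List.mem_take_iff_getElem]
  constructor
  · intro ha
    refine ⟨l.idxOf a, ?_, ?_⟩
    · have : l.idxOf a < t := by simpa using ha
      have := List.idxOf_lt_length_of_mem (hmem a)
      omega
    · simp
  · rintro ⟨k, hk, rfl⟩
    have : l.idxOf l[k] = k := hl.idxOf_getElem k (by omega)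
    simp [this]
    omega

end Chains

/-! ### Crusades and their monotone minimisers -/

section Crusades

open scoped Classical

variable {V : Type*} [Fintype V]

/-- A crusade of length `n` below `γ`: a sequence of sets from `∅` to the whole vertex set, each
having energy less than `γ` and at most one vertex that the previous set lacks. -/
structure IsCrusade (E : Finset V → ℝ) (γ : ℝ) {n : ℕ} (X : Fin (n + 1) → Finset V) : Prop where
  zero : X 0 = ∅
  last : X (Fin.last n) = Finset.univ
  lt : ∀ j, E (X j) < γ
  card_le : ∀ j : Fin n, (X j.succ \ X j.castSucc).card ≤ 1

theorem IsCrusade.update {E : Finset V → ℝ} {γ : ℝ} {n : ℕ} {X : Fin (n + 1) → Finset V}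
    (hX : IsCrusade E γ X) {k : Fin (n + 1)} (h0 : k ≠ 0) (hl : k ≠ Fin.last n) {S : Finset V}
    (hS : E S < γ) (hprev : ∀ j : Fin n, j.succ = k → (S \ X j.castSucc).card ≤ 1)
    (hnext : ∀ j : Fin n, j.castSucc = k → (X j.succ \ S).card ≤ 1) :
    IsCrusade E γ (Function.update X k S) where
  zero := by rw [Function.update_of_ne h0.symm, hX.zero]
  last := by rw [Function.update_of_ne hl.symm, hX.last]
  lt j := by
    by_cases hj : j = k
    · subst hj; simpa using hS
    · rw [Function.update_of_ne hj]; exact hX.lt j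
  card_le j := by
    have hne : j.castSucc ≠ j.succ := (Fin.castSucc_lt_succ).ne
    by_cases h1 : j.succ = k
    · have h2 : j.castSucc ≠ k := fun h => hne (h.trans h1.symm)
      rw [Function.update_of_ne h2, h1, Function.update_self]
      exact hprev j h1
    · rw [Function.update_of_ne h1]
      by_cases h2 : j.castSucc = k
      · rw [h2, Function.update_self]
        exact hnext j h2
      · rw [Function.update_of_ne h2]
        exact hX.card_le j

theorem sum_comp_update {ι α M : Type*} [Fintype ι] [DecidableEq ι] [AddCommGroup M] (f : α → M) (X : ι → α)
    (k : ι) (a : α) :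
    ∑ j, f (Function.update X k a j) = ∑ j, f (X j) - f (X k) + f a := by
  rw [← Finset.add_sum_erase _ _ (Finset.mem_univ k),
    ← Finset.add_sum_erase _ (fun j => f (X j)) (Finset.mem_univ k), Function.update_self]
  rw [Finset.sum_congr rfl fun j hj => by rw [Function.update_of_ne (Finset.ne_of_mem_erase hj)]]
  abel

/-- A crusade of minimal total energy, and then of minimal total cardinality, is increasing
(Bienstock and Seymour). -/
theorem IsCrusade.exists_monotone {E : Finset V → ℝ}
    (hE : ∀ S T, E (S ∪ T) + E (S ∩ T) ≤ E S + E T) {γ : ℝ} {n : ℕ} {X : Fin (n + 1) → Finset V}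
    (hX : IsCrusade E γ X) :
    ∃ Y : Fin (n + 1) → Finset V, IsCrusade E γ Y ∧ ∀ j : Fin n, Y j.castSucc ⊆ Y j.succ := by
  obtain ⟨Y, hY, hmin⟩ := Set.exists_min_image {Y : Fin (n + 1) → Finset V | IsCrusade E γ Y}
    (fun Y => toLex (∑ j, E (Y j), ∑ j, ((Y j).card : ℤ))) (Set.toFinite _) ⟨X, hX⟩
  refine ⟨Y, hY, fun j => ?_⟩
  have hcj := hY.card_le j
  have hmin' : ∀ {k S}, IsCrusade E γ (Function.update Y k S) →
      E (Y k) < E S ∨ (E (Y k) = E S ∧ (Y k).card ≤ S.card) := by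
    intro k S hS
    have h1 := hmin _ hS
    rw [Prod.Lex.toLex_le_toLex] at h1
    simp only [sum_comp_update (fun S : Finset V => E S),
      sum_comp_update (fun S : Finset V => (S.card : ℤ))] at h1
    rcases h1 with h1 | ⟨h1, h2⟩
    · left; linarith
    · right; constructor
      · linarith
      · omega
  -- First exchange: replacing the later set by the union keeps the crusade admissible, so lower
  -- energy for the union would contradict minimality.
  have step : E (Y j.succ) ≤ E (Y j.castSucc ∪ Y j.succ) := by
    by_cases hl : j.succ = Fin.last n
    · rw [hl, hY.last, Finset.univ_subset_iff.1 Finset.subset_union_right]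
    · by_contra! hlt
      have := hmin' (hY.update (Fin.succ_ne_zero j) hl (hlt.trans (hY.lt _))
        (fun i hi => by
          rw [Fin.succ_inj] at hi
          subst hi
          rwa [Finset.union_sdiff_left])
        (fun i hi => (Finset.card_le_card (Finset.sdiff_subset_sdiff le_rfl (by
          rw [hi]; exact Finset.subset_union_right))).trans (hY.card_le i)))
      rcases this with h | ⟨h, -⟩ <;> linarith
  by_cases h0 : j.castSucc = 0
  · rw [h0, hY.zero]; exact Finset.empty_subset _
  -- Second exchange: submodularity and `step` make the intersection no more expensive than the
  -- earlier set. Replacing that set cannot lower the energy, so the energies agree, and minimal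
  -- cardinality forces the intersection to be the whole set.
  · have hle : E (Y j.castSucc ∩ Y j.succ) ≤ E (Y j.castSucc) := by
      linarith [hE (Y j.castSucc) (Y j.succ)]
    have := hmin' (hY.update h0 (Fin.castSucc_lt_last j).ne (hle.trans_lt (hY.lt _))
      (fun i hi => (Finset.card_le_card (Finset.sdiff_subset_sdiff
        (by rw [hi]; exact Finset.inter_subset_left) le_rfl)).trans (hY.card_le i))
      (fun i hi => by
        rw [Fin.castSucc_inj] at hi
        subst hi
        rwa [Finset.sdiff_inter_self_right]))
    rcases this with h | ⟨-, h⟩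
    · linarith
    · exact Finset.inter_eq_left.1 (Finset.eq_of_subset_of_card_le Finset.inter_subset_left h)

theorem IsCrusade.climbs {E : Finset V → ℝ}
    (hE : ∀ S T, E (S ∪ T) + E (S ∩ T) ≤ E S + E T) {γ : ℝ} {n : ℕ} {X : Fin (n + 1) → Finset V}
    (hX : IsCrusade E γ X) : Climbs (fun S => E S < γ) ∅ Finset.univ := by
  obtain ⟨Y, hY, hmono⟩ := hX.exists_monotone hE
  have key := Climbs.of_subset_chain (P := fun S => E S < γ)
    (X := fun j => Y (Fin.ofNat (n + 1) j)) (n := n) (fun j _ => hY.lt _)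
  have hs : ∀ j (hj : j < n), Fin.ofNat (n + 1) j = (⟨j, hj⟩ : Fin n).castSucc ∧
      Fin.ofNat (n + 1) (j + 1) = (⟨j, hj⟩ : Fin n).succ := by
    intro j hj
    constructor <;> ext <;> simp <;> omega
  have h1 : Fin.ofNat (n + 1) n = Fin.last n := by ext; simp
  have := key (fun j hj => by rw [(hs j hj).1, (hs j hj).2]; exact hmono _)
    (fun j hj => by rw [(hs j hj).1, (hs j hj).2]; exact hY.card_le _)
  simpa [h1, hY.zero, hY.last] using this

end Crusades

/-! ### Duality between tilted cut and tilted cutwidth -/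

section MinMax

open scoped Classical

variable {V : Type*} [Fintype V]

@[simp]
theorem initialSet_zero (σ : Fin (Fintype.card V) ≃ V) : initialSet σ 0 = ∅ := by
  simp [initialSet]

@[simp]
theorem initialSet_card (σ : Fin (Fintype.card V) ≃ V) :
    initialSet σ (Fintype.card V) = Finset.univ := by
  simp [initialSet]

theorem initialSet_succ (σ : Fin (Fintype.card V) ≃ V) {t : ℕ} (ht : t < Fintype.card V) :
    initialSet σ (t + 1) = insert (σ ⟨t, ht⟩) (initialSet σ t) := by
  ext v
  simp only [initialSet, Finset.mem_filter, Finset.mem_univ, true_and, Finset.mem_insert]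
  rw [← Equiv.symm_apply_eq, Fin.ext_iff]
  simp only
  omega

/-- Every ordering of the vertices crosses the boundary of every monotone family. -/
theorem IsMonotoneFamily.exists_crossing {Ω : Set (Finset V)} (hΩ : IsMonotoneFamily Ω)
    (σ : Fin (Fintype.card V) ≃ V) :
    ∃ t < Fintype.card V, (initialSet σ t, initialSet σ (t + 1)) ∈ boundary Ω := by
  by_contra! hcon
  have : ∀ t ≤ Fintype.card V, initialSet σ t ∈ Ω := by
    intro t
    induction t with
    | zero => intro _; simpa using hΩ.1
    | succ t ih =>
      intro ht
      by_contra hn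
      exact hcon t ht ⟨ih (by omega), hn, _, initialSet_succ σ ht⟩
  exact hΩ.2.1 (by simpa using this _ le_rfl)

theorem IsMonotoneFamily.nonempty_boundary {Ω : Set (Finset V)} (hΩ : IsMonotoneFamily Ω) :
    Nonempty (boundary Ω) := by
  obtain ⟨t, -, ht⟩ := hΩ.exists_crossing (Fintype.equivFin V).symm
  exact ⟨⟨_, ht⟩⟩

theorem isMonotoneFamily_singleton_empty [Nonempty V] :
    IsMonotoneFamily ({∅} : Set (Finset V)) := by
  refine ⟨rfl, ?_, ?_⟩
  · exact (Finset.univ_nonempty (α := V)).ne_empty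
  · rintro S rfl S' hS'
    exact Finset.subset_empty.1 hS'

theorem nonempty_orderings : Nonempty (Fin (Fintype.card V) ≃ V) :=
  ⟨(Fintype.equivFin V).symm⟩

theorem le_tiltedCut {G : SimpleGraph V} {h : V → ℝ} {Ω : Set (Finset V)}
    (hΩ : IsMonotoneFamily Ω) {a : ℝ}
    (ha : ∀ p ∈ boundary Ω, a ≤ max (tiltedEnergy G h p.1) (tiltedEnergy G h p.2)) :
    a ≤ tiltedCut G h := by
  have := hΩ.nonempty_boundary
  refine le_ciSup_of_le (Set.finite_range _).bddAbove ⟨Ω, hΩ⟩ ?_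
  exact le_ciInf fun p => ha p.1 p.2

theorem tiltedCut_nonneg [Nonempty V] (G : SimpleGraph V) (h : V → ℝ) : 0 ≤ tiltedCut G h := by
  refine le_tiltedCut isMonotoneFamily_singleton_empty fun p hp => ?_
  have : p.1 = ∅ := hp.1
  rw [this, tiltedEnergy_empty]
  exact le_max_left _ _

/-- Weak duality: any ordering crosses the boundary of any monotone family, and both sets of the
crossing pair are prefixes of the ordering. -/
theorem tiltedCut_le_tiltedCutwidth [Nonempty V] (G : SimpleGraph V) (h : V → ℝ) :
    tiltedCut G h ≤ tiltedCutwidth G h := by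
  have := nonempty_orderings (V := V)
  have : Nonempty {Ω : Set (Finset V) // IsMonotoneFamily Ω} :=
    ⟨⟨_, isMonotoneFamily_singleton_empty⟩⟩
  refine le_ciInf fun σ => ciSup_le fun Ω => ?_
  obtain ⟨t, ht, hp⟩ := Ω.2.exists_crossing σ
  refine (ciInf_le (Set.finite_range _).bddBelow ⟨_, hp⟩).trans (max_le ?_ ?_)
  · exact le_ciSup (f := fun t : Fin (Fintype.card V + 1) => tiltedEnergy G h (initialSet σ t))
      (Set.finite_range _).bddAbove ⟨t, by omega⟩
  · exact le_ciSup (f := fun t : Fin (Fintype.card V + 1) => tiltedEnergy G h (initialSet σ t))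
      (Set.finite_range _).bddAbove ⟨t + 1, by omega⟩

/-- If no crusade below `γ` reached the full set, the subsets of endpoints of partial crusades would
be a monotone family each of whose boundary pairs has a member of energy at least `γ`, so the tilted
cut would be at least `γ`. -/
theorem climbs_of_tiltedCut_lt [Nonempty V] {G : SimpleGraph V} {h : V → ℝ} {γ : ℝ}
    (hγ : tiltedCut G h < γ) : Climbs (fun S => tiltedEnergy G h S < γ) ∅ Finset.univ := by
  set Ω : Set (Finset V) := {S | ∃ (n : ℕ) (X : Fin (n + 1) → Finset V), X 0 = ∅ ∧
    S ⊆ X (Fin.last n) ∧ (∀ j, tiltedEnergy G h (X j) < γ) ∧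
    ∀ j : Fin n, (X j.succ \ X j.castSucc).card ≤ 1} with hΩ
  have hpos : 0 < γ := (tiltedCut_nonneg G h).trans_lt hγ
  -- Extend the crusade by `S` and then `T`. Dropping from its endpoint to the subset `S` is free
  -- because only added vertices count.
  have hext : ∀ S T, S ∈ Ω → tiltedEnergy G h T < γ → (T \ S).card ≤ 1 →
      tiltedEnergy G h S < γ → T ∈ Ω := by
    rintro S T ⟨n, X, h0, hS, hlt, hc⟩ hT hST hSγ
    have hc1 : ∀ j : Fin (n + 1), ((Fin.snoc X S : Fin (n + 2) → Finset V) j.succ \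
        (Fin.snoc X S : Fin (n + 2) → Finset V) j.castSucc).card ≤ 1 := by
      intro j
      rw [Fin.snoc_castSucc]
      refine Fin.lastCases ?_ (fun j => ?_) j
      · rw [Fin.succ_last, Fin.snoc_last, Finset.sdiff_eq_empty_iff_subset.2 hS]
        simp
      · rw [← Fin.castSucc_succ, Fin.snoc_castSucc]
        exact hc j
    have hl1 : ∀ j : Fin (n + 2), tiltedEnergy G h
        ((Fin.snoc X S : Fin (n + 2) → Finset V) j) < γ := by
      intro j
      refine Fin.lastCases ?_ (fun j => ?_) j
      · simpa using hSγ
      · simpa using hlt j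
    refine ⟨n + 2, (Fin.snoc (Fin.snoc X S : Fin (n + 2) → Finset V) T :
      Fin (n + 3) → Finset V), ?_, ?_, ?_, ?_⟩
    · rw [← Fin.castSucc_zero, Fin.snoc_castSucc, ← Fin.castSucc_zero, Fin.snoc_castSucc, h0]
    · simp
    · intro j
      refine Fin.lastCases ?_ (fun j => ?_) j
      · simpa using hT
      · simpa using hl1 j
    · intro j
      rw [Fin.snoc_castSucc]
      refine Fin.lastCases ?_ (fun j => ?_) j
      · rw [Fin.succ_last, Fin.snoc_last, Fin.snoc_last]
        exact hST
      · rw [← Fin.castSucc_succ, Fin.snoc_castSucc]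
        exact hc1 j
  by_cases hu : (Finset.univ : Finset V) ∈ Ω
  · obtain ⟨n, X, h0, hS, hlt, hc⟩ := hu
    exact IsCrusade.climbs (X := X) (tiltedEnergy_submodular G h)
      ⟨h0, Finset.univ_subset_iff.1 hS, hlt, hc⟩
  · exfalso
    refine hγ.not_ge (le_tiltedCut (Ω := Ω) ⟨?_, hu, ?_⟩ ?_)
    · exact ⟨0, fun _ => ∅, rfl, le_rfl, fun _ => by simpa using hpos, fun j => j.elim0⟩
    · rintro S ⟨n, X, h0, hS, hr⟩ S' hS'
      exact ⟨n, X, h0, hS'.trans hS, hr⟩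
    · rintro ⟨S, T⟩ ⟨h1, h2, i, hi⟩
      by_contra! hlt
      rw [max_lt_iff] at hlt
      refine h2 (hext S T h1 hlt.2 ?_ hlt.1)
      simp only at hi
      subst hi
      refine (Finset.card_le_card (t := {i}) fun a ha => ?_).trans (by simp)
      simp only [Finset.mem_sdiff, Finset.mem_insert, Finset.mem_singleton] at ha ⊢
      tauto

theorem tiltedCut_eq_tiltedCutwidth [Nonempty V] (G : SimpleGraph V) (h : V → ℝ) :
    tiltedCut G h = tiltedCutwidth G h := by
  refine le_antisymm (tiltedCut_le_tiltedCutwidth G h) (le_of_not_gt fun hlt => ?_)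
  obtain ⟨σ, hσ⟩ := (climbs_of_tiltedCut_lt hlt).exists_ordering
  refine lt_irrefl (tiltedCutwidth G h) ?_
  refine (ciInf_le (Set.finite_range _).bddBelow σ).trans_lt ?_
  obtain ⟨t, ht⟩ := exists_eq_ciSup_of_finite
    (f := fun t : Fin (Fintype.card V + 1) => tiltedEnergy G h (initialSet σ t))
  rw [← ht]
  exact hσ t

theorem maxTiltedCutwidth_eq_maxTiltedCut (G : SimpleGraph V) (h : V → ℝ) :
    maxTiltedCutwidth G h = maxTiltedCut G h := by
  unfold maxTiltedCutwidth maxTiltedCut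
  congr 1
  funext F
  have : Nonempty F.1 := F.2.to_subtype
  exact (tiltedCut_eq_tiltedCutwidth _ _).symm

/-- Some ordering attains the tilted cutwidth. -/
theorem exists_ordering_le_tiltedCutwidth (G : SimpleGraph V) (h : V → ℝ) :
    ∃ σ : Fin (Fintype.card V) ≃ V, ∀ t ≤ Fintype.card V,
      tiltedEnergy G h (initialSet σ t) ≤ tiltedCutwidth G h := by
  have := nonempty_orderings (V := V)
  obtain ⟨σ, hσ⟩ := exists_eq_ciInf_of_finite (f := fun σ : Fin (Fintype.card V) ≃ V =>
    ⨆ t : Fin (Fintype.card V + 1), tiltedEnergy G h (initialSet σ t))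
  refine ⟨σ, fun t ht => ?_⟩
  unfold tiltedCutwidth
  rw [← hσ]
  exact le_ciSup (f := fun t : Fin (Fintype.card V + 1) => tiltedEnergy G h (initialSet σ t))
    (Set.finite_range _).bddAbove ⟨t, by omega⟩

/-- Some monotone family attains the tilted cut. -/
theorem exists_tiltedCut_le [Nonempty V] (G : SimpleGraph V) (h : V → ℝ) :
    ∃ Ω : Set (Finset V), IsMonotoneFamily Ω ∧ ∀ p ∈ boundary Ω,
      tiltedCut G h ≤ max (tiltedEnergy G h p.1) (tiltedEnergy G h p.2) := by
  have : Nonempty {Ω : Set (Finset V) // IsMonotoneFamily Ω} :=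
    ⟨⟨_, isMonotoneFamily_singleton_empty⟩⟩
  obtain ⟨Ω, hΩ⟩ := exists_eq_ciSup_of_finite
    (f := fun Ω : {Ω : Set (Finset V) // IsMonotoneFamily Ω} => ⨅ p : boundary Ω.1,
      max (tiltedEnergy G h p.1.1) (tiltedEnergy G h p.1.2))
  refine ⟨Ω.1, Ω.2, fun p hp => ?_⟩
  unfold tiltedCut
  rw [← hΩ]
  exact ciInf_le (Set.finite_range _).bddBelow (⟨p, hp⟩ : boundary Ω.1)

end MinMax

/-! ### Heat bath on sets: reversibility and attractiveness -/

section HeatBathOnSets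

open scoped Classical

variable {V : Type*}

/-- The heat bath probability that the updated vertex `i` joins the set `S`, for the energy
`2 * E` at inverse temperature `β`. -/
def joinProb (E : Finset V → ℝ) (β : ℝ) (S : Finset V) (i : V) : ℝ :=
  (1 + Real.exp (2 * β * (E (insert i S) - E (S.erase i))))⁻¹

/-- The equilibrium flow of the heat bath dynamics between `S.erase i` and `insert i S`. -/
def conductance (E : Finset V → ℝ) (β : ℝ) (S : Finset V) (i : V) : ℝ :=
  (Real.exp (2 * β * E (insert i S)) + Real.exp (2 * β * E (S.erase i)))⁻¹

/-- The unnormalised Gibbs weight. -/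
def gibbs (E : Finset V → ℝ) (β : ℝ) (S : Finset V) : ℝ := Real.exp (-(2 * β * E S))

theorem gibbs_pos (E : Finset V → ℝ) (β : ℝ) (S : Finset V) : 0 < gibbs E β S := Real.exp_pos _

theorem conductance_pos (E : Finset V → ℝ) (β : ℝ) (S : Finset V) (i : V) :
    0 < conductance E β S i := by
  unfold conductance; positivity

theorem joinProb_pos (E : Finset V → ℝ) (β : ℝ) (S : Finset V) (i : V) :
    0 < joinProb E β S i := by
  unfold joinProb; positivity

theorem joinProb_le_one (E : Finset V → ℝ) (β : ℝ) (S : Finset V) (i : V) :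
    joinProb E β S i ≤ 1 :=
  inv_le_one_of_one_le₀ (by linarith [Real.exp_pos (2 * β * (E (insert i S) - E (S.erase i)))])

/-- Together with `gibbs_mul_one_sub_joinProb`, this is detailed balance: the flow is the same in
both directions. -/
theorem gibbs_mul_joinProb (E : Finset V → ℝ) (β : ℝ) (S : Finset V) (i : V) :
    gibbs E β (S.erase i) * joinProb E β S i = conductance E β S i := by
  unfold gibbs joinProb conductance
  rw [Real.exp_neg, ← mul_inv, mul_add, ← Real.exp_add, mul_one, add_comm]
  ring_nf

theorem gibbs_mul_one_sub_joinProb (E : Finset V → ℝ) (β : ℝ) (S : Finset V) (i : V) :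
    gibbs E β (insert i S) * (1 - joinProb E β S i) = conductance E β S i := by
  rw [← gibbs_mul_joinProb]
  unfold gibbs joinProb
  have h1 : Real.exp (-(2 * β * E (S.erase i))) = Real.exp (-(2 * β * E (insert i S))) *
      Real.exp (2 * β * (E (insert i S) - E (S.erase i))) := by
    rw [← Real.exp_add]; ring_nf
  rw [h1]
  have := Real.exp_pos (2 * β * (E (insert i S) - E (S.erase i)))
  field_simp
  ring

theorem le_conductance {E : Finset V → ℝ} {β : ℝ} (hβ : 0 ≤ β) {c : ℝ} {S : Finset V} {i : V}
    (h1 : E (insert i S) ≤ c) (h2 : E (S.erase i) ≤ c) :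
    Real.exp (-(2 * β * c)) / 2 ≤ conductance E β S i := by
  have h3 : Real.exp (2 * β * E (insert i S)) ≤ Real.exp (2 * β * c) :=
    Real.exp_le_exp.2 (mul_le_mul_of_nonneg_left h1 (by linarith))
  have h4 : Real.exp (2 * β * E (S.erase i)) ≤ Real.exp (2 * β * c) :=
    Real.exp_le_exp.2 (mul_le_mul_of_nonneg_left h2 (by linarith))
  unfold conductance
  rw [Real.exp_neg, div_eq_mul_inv, ← mul_inv]
  exact inv_anti₀ (by positivity) (by linarith)

theorem conductance_le {E : Finset V → ℝ} {β : ℝ} (hβ : 0 ≤ β) {c : ℝ} {S : Finset V} {i : V}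
    (h : c ≤ max (E (S.erase i)) (E (insert i S))) :
    conductance E β S i ≤ Real.exp (-(2 * β * c)) := by
  unfold conductance
  rw [Real.exp_neg]
  have h0 : (0 : ℝ) ≤ 2 * β := by linarith
  refine inv_anti₀ (Real.exp_pos _) ?_
  rcases le_max_iff.1 h with h | h
  · have := Real.exp_le_exp.2 (mul_le_mul_of_nonneg_left h h0)
    linarith [Real.exp_pos (2 * β * E (insert i S))]
  · have := Real.exp_le_exp.2 (mul_le_mul_of_nonneg_left h h0)
    linarith [Real.exp_pos (2 * β * E (S.erase i))]

theorem joinProb_insert (E : Finset V → ℝ) (β : ℝ) {S : Finset V} {i : V} (hi : i ∉ S) :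
    joinProb E β (insert i S) i = joinProb E β S i := by
  unfold joinProb
  rw [Finset.insert_idem, Finset.erase_insert hi, Finset.erase_eq_of_notMem hi]

/-- Attractiveness: submodularity applied to `insert i S` and `T.erase i` says that adding `i` costs
less energy over the larger set. -/
theorem joinProb_mono {E : Finset V → ℝ} (hE : ∀ S T, E (S ∪ T) + E (S ∩ T) ≤ E S + E T)
    {β : ℝ} (hβ : 0 ≤ β) {S T : Finset V} (hST : S ⊆ T) (i : V) :
    joinProb E β S i ≤ joinProb E β T i := by
  unfold joinProb
  have h := hE (insert i S) (T.erase i)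
  have h1 : insert i S ∪ T.erase i = insert i T := by
    ext a
    by_cases ha : a = i
    · simp [ha]
    · simp only [Finset.mem_union, Finset.mem_insert, Finset.mem_erase, ha]
      have := @hST a
      tauto
  have h2 : insert i S ∩ T.erase i = S.erase i := by
    ext a
    by_cases ha : a = i
    · simp [ha]
    · simp only [Finset.mem_inter, Finset.mem_insert, Finset.mem_erase, ha]
      have := @hST a
      tauto
  rw [h1, h2] at h
  have h3 : 2 * β * (E (insert i T) - E (T.erase i)) ≤
      2 * β * (E (insert i S) - E (S.erase i)) :=
    mul_le_mul_of_nonneg_left (by linarith) (by linarith)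
  gcongr

/-- The mean of `f` after an update of the vertex `i` in `S`. -/
def siteMean (E : Finset V → ℝ) (β : ℝ) (f : Finset V → ℝ) (S : Finset V) (i : V) : ℝ :=
  joinProb E β S i * f (insert i S) + (1 - joinProb E β S i) * f (S.erase i)

theorem siteMean_mono {E : Finset V → ℝ} {β : ℝ} {f g : Finset V → ℝ} (hfg : ∀ S, f S ≤ g S)
    (S : Finset V) (i : V) : siteMean E β f S i ≤ siteMean E β g S i :=
  add_le_add (mul_le_mul_of_nonneg_left (hfg _) (joinProb_pos E β S i).le)
    (mul_le_mul_of_nonneg_left (hfg _) (sub_nonneg.2 (joinProb_le_one E β S i)))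

@[simp]
theorem siteMean_const (E : Finset V → ℝ) (β c : ℝ) (S : Finset V) (i : V) :
    siteMean E β (fun _ => c) S i = c := by
  unfold siteMean; ring

theorem siteMean_le_of_monotone {E : Finset V → ℝ}
    (hE : ∀ S T, E (S ∪ T) + E (S ∩ T) ≤ E S + E T) {β : ℝ} (hβ : 0 ≤ β) {f : Finset V → ℝ}
    (hf : ∀ S T, S ⊆ T → f S ≤ f T) {S T : Finset V} (hST : S ⊆ T) (i : V) :
    siteMean E β f S i ≤ siteMean E β f T i := by
  unfold siteMean
  have h1 := joinProb_mono hE hβ hST i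
  have h2 := hf _ _ (Finset.insert_subset_insert i hST)
  have h3 := hf _ _ (Finset.erase_subset_erase i hST)
  have h4 : f (S.erase i) ≤ f (insert i S) :=
    hf _ _ ((Finset.erase_subset i S).trans (Finset.subset_insert i S))
  have h5 := joinProb_pos E β T i
  have h6 := joinProb_le_one E β T i
  nlinarith [mul_nonneg (sub_nonneg.2 h1) (sub_nonneg.2 h4),
    mul_nonneg h5.le (sub_nonneg.2 h2), mul_nonneg (sub_nonneg.2 h6) (sub_nonneg.2 h3)]

theorem siteMean_le_insert {E : Finset V → ℝ} {β : ℝ} {f : Finset V → ℝ}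
    (hf : ∀ S T, S ⊆ T → f S ≤ f T) (S : Finset V) (i : V) :
    siteMean E β f S i ≤ f (insert i S) := by
  unfold siteMean
  have h4 : f (S.erase i) ≤ f (insert i S) :=
    hf _ _ ((Finset.erase_subset i S).trans (Finset.subset_insert i S))
  nlinarith [mul_nonneg (sub_nonneg.2 (joinProb_le_one E β S i)) (sub_nonneg.2 h4)]

variable [Fintype V]

/-- The transition operator: the mean of `f` after the update of a uniform vertex. -/
def heatOp (E : Finset V → ℝ) (β : ℝ) (f : Finset V → ℝ) (S : Finset V) : ℝ :=
  (∑ i, siteMean E β f S i) / Fintype.card V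

theorem heatOp_mono {E : Finset V → ℝ} {β : ℝ} {f g : Finset V → ℝ} (hfg : ∀ S, f S ≤ g S)
    (S : Finset V) : heatOp E β f S ≤ heatOp E β g S :=
  div_le_div_of_nonneg_right (Finset.sum_le_sum fun i _ => siteMean_mono hfg S i) (by positivity)

@[simp]
theorem heatOp_const [Nonempty V] (E : Finset V → ℝ) (β c : ℝ) (S : Finset V) :
    heatOp E β (fun _ => c) S = c := by
  simp [heatOp]

theorem heatOp_sum {ι : Type*} (s : Finset ι) (E : Finset V → ℝ) (β : ℝ) (f : ι → Finset V → ℝ)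
    (S : Finset V) : heatOp E β (fun T => ∑ y ∈ s, f y T) S = ∑ y ∈ s, heatOp E β (f y) S := by
  unfold heatOp siteMean
  rw [← Finset.sum_div, Finset.sum_comm]
  congr 1
  refine Finset.sum_congr rfl fun i _ => ?_
  rw [Finset.mul_sum, Finset.mul_sum, ← Finset.sum_add_distrib]

theorem heatOp_const_mul (E : Finset V → ℝ) (β c : ℝ) (f : Finset V → ℝ) (S : Finset V) :
    heatOp E β (fun T => c * f T) S = c * heatOp E β f S := by
  unfold heatOp siteMean
  rw [mul_div_assoc', Finset.mul_sum]
  congr 1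
  refine Finset.sum_congr rfl fun i _ => ?_
  ring

/-- The probability that the dynamics started from `S` hits the full set within `m` updates. -/
def hitProb (E : Finset V → ℝ) (β : ℝ) : ℕ → Finset V → ℝ
  | 0, S => if S = Finset.univ then 1 else 0
  | m + 1, S => if S = Finset.univ then 1 else heatOp E β (hitProb E β m) S

theorem hitProb_le_one [Nonempty V] (E : Finset V → ℝ) (β : ℝ) (m : ℕ) (S : Finset V) :
    hitProb E β m S ≤ 1 := by
  induction m generalizing S with
  | zero => unfold hitProb; split_ifs <;> norm_num
  | succ m ih =>
    unfold hitProb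
    split_ifs
    · rfl
    · exact (heatOp_mono ih S).trans_eq (heatOp_const E β 1 S)

theorem hitProb_nonneg [Nonempty V] (E : Finset V → ℝ) (β : ℝ) (m : ℕ) (S : Finset V) :
    0 ≤ hitProb E β m S := by
  induction m generalizing S with
  | zero => unfold hitProb; split_ifs <;> norm_num
  | succ m ih =>
    unfold hitProb
    split_ifs
    · norm_num
    · exact (heatOp_const E β 0 S).symm.trans_le (heatOp_mono ih S)

theorem sum_finset_eq_sum_pairs (i : V) (φ : Finset V → ℝ) :
    ∑ S, φ S = ∑ T ∈ (Finset.univ.erase i).powerset, (φ T + φ (insert i T)) := by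
  have h : (Finset.univ : Finset (Finset V)) = (insert i (Finset.univ.erase i)).powerset := by
    rw [Finset.insert_erase (Finset.mem_univ i), Finset.powerset_univ]
  rw [h, Finset.sum_powerset_insert (Finset.notMem_erase i _), Finset.sum_add_distrib]

theorem notMem_of_mem_powerset_erase {i : V} {T : Finset V}
    (hT : T ∈ (Finset.univ.erase i).powerset) : i ∉ T :=
  fun h => Finset.notMem_erase i _ (Finset.mem_powerset.1 hT h)

/-- The Dirichlet form of a single site. -/
theorem sum_gibbs_mul_sub_siteMean (E : Finset V → ℝ) (β : ℝ) (g : Finset V → ℝ) (i : V) :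
    ∑ S, gibbs E β S * (g S * (g S - siteMean E β g S i)) =
      ∑ T ∈ (Finset.univ.erase i).powerset,
        conductance E β T i * (g (insert i T) - g T) ^ 2 := by
  rw [sum_finset_eq_sum_pairs i]
  refine Finset.sum_congr rfl fun T hT => ?_
  have hi := notMem_of_mem_powerset_erase hT
  have h1 := gibbs_mul_joinProb E β T i
  have h2 := gibbs_mul_one_sub_joinProb E β T i
  rw [Finset.erase_eq_of_notMem hi] at h1
  simp only [siteMean, joinProb_insert E β hi, Finset.insert_idem, Finset.erase_insert hi,
    Finset.erase_eq_of_notMem hi]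
  linear_combination (g T * (g T - g (insert i T))) * h1 +
    (g (insert i T) * (g (insert i T) - g T)) * h2

end HeatBathOnSets

/-! ### Upper bound through the Green function -/

section UpperBound

open scoped Classical

variable {V : Type*} [Fintype V]

/-- The expected number of visits to `y` among the first `m` configurations of the dynamics killed
at the full set. -/
def green (E : Finset V → ℝ) (β : ℝ) (y : Finset V) : ℕ → Finset V → ℝ
  | 0, _ => 0
  | m + 1, S => if S = Finset.univ then 0 else
      (if S = y then 1 else 0) + heatOp E β (green E β y m) S

theorem green_univ (E : Finset V → ℝ) (β : ℝ) (y : Finset V) (m : ℕ) :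
    green E β y m Finset.univ = 0 := by
  cases m <;> simp [green]

theorem green_nonneg [Nonempty V] (E : Finset V → ℝ) (β : ℝ) (y : Finset V) (m : ℕ)
    (S : Finset V) : 0 ≤ green E β y m S := by
  induction m generalizing S with
  | zero => simp [green]
  | succ m ih =>
    unfold green
    have := (heatOp_const E β 0 S).symm.trans_le (heatOp_mono ih S)
    split_ifs <;> linarith

theorem green_le_succ [Nonempty V] (E : Finset V → ℝ) (β : ℝ) (y : Finset V) (m : ℕ)
    (S : Finset V) : green E β y m S ≤ green E β y (m + 1) S := by
  induction m generalizing S with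
  | zero => exact green_nonneg E β y 1 S
  | succ m ih =>
    rw [green, green]
    have := heatOp_mono (E := E) (β := β) ih S
    split_ifs <;> linarith

/-- Maximum principle: visits to `y` are counted only from the first arrival at `y`, with no more
steps left. -/
theorem green_le_diag [Nonempty V] (E : Finset V → ℝ) (β : ℝ) (y : Finset V) (m : ℕ)
    (S : Finset V) : green E β y m S ≤ green E β y m y := by
  induction m generalizing S with
  | zero => simp [green]
  | succ m ih =>
    by_cases hS : S = y
    · rw [hS]
    · by_cases hu : S = Finset.univ
      · rw [hu, green_univ]; exact green_nonneg E β y _ y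
      · rw [green, if_neg hu, if_neg hS, zero_add]
        refine (heatOp_mono ih S).trans ?_
        rw [heatOp_const]
        exact green_le_succ E β y m y

/-- Pair `g` with `g - Pg` in the Gibbs weight, where `P` is the transition operator. Monotonicity
in `m` gives `g ≤ 1_y + Pg` off the full set, and `g` vanishes on the full set, so only the term at
`y` can contribute positively. -/
theorem sum_dirichlet_green_le [Nonempty V] (E : Finset V → ℝ) (β : ℝ) (y : Finset V) (m : ℕ) :
    ∑ i, ∑ T ∈ (Finset.univ.erase i).powerset,
        conductance E β T i * (green E β y m (insert i T) - green E β y m T) ^ 2 ≤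
      Fintype.card V * (gibbs E β y * green E β y m y) := by
  set g := green E β y m with hg
  have hn : (0 : ℝ) < Fintype.card V := by exact_mod_cast Fintype.card_pos
  have h1 : ∀ S, ∑ i, gibbs E β S * (g S * (g S - siteMean E β g S i)) =
      Fintype.card V * (gibbs E β S * (g S * (g S - heatOp E β g S))) := by
    intro S
    rw [← Finset.mul_sum, ← Finset.mul_sum, Finset.sum_sub_distrib]
    unfold heatOp
    simp only [Finset.sum_const, Finset.card_univ, nsmul_eq_mul]
    field_simp
  have h2 : ∀ S, gibbs E β S * (g S * (g S - heatOp E β g S)) ≤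
      if S = y then gibbs E β y * g y else 0 := by
    intro S
    have hμ := gibbs_pos E β S
    have h0 : 0 ≤ g S := green_nonneg E β y m S
    by_cases hu : S = Finset.univ
    · have : g S = 0 := by rw [hu]; exact green_univ E β y m
      rw [this]
      split_ifs
      · simpa using mul_nonneg (gibbs_pos E β y).le (green_nonneg E β y m y)
      · simp
    · have h3 : g S ≤ (if S = y then 1 else 0) + heatOp E β g S := by
        have := green_le_succ E β y m S
        rwa [green, if_neg hu] at this
      split_ifs at h3 ⊢ with hy
      · rw [← hy]
        exact mul_le_mul_of_nonneg_left (by nlinarith) hμ.le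
      · exact mul_nonpos_of_nonneg_of_nonpos hμ.le
          (mul_nonpos_of_nonneg_of_nonpos h0 (by linarith))
  simp_rw [← sum_gibbs_mul_sub_siteMean]
  rw [Finset.sum_comm]
  simp_rw [h1]
  rw [← Finset.mul_sum]
  refine mul_le_mul_of_nonneg_left ((Finset.sum_le_sum fun S _ => h2 S).trans_eq ?_) hn.le
  simp

/-- Along a climb, the truncated Green function changes by at most a fixed amount per step. -/
theorem Climbs.green_le [Nonempty V] {E : Finset V → ℝ} {β : ℝ} (hβ : 0 ≤ β) {y : Finset V}
    {γ : ℝ} (m : ℕ) {T : Finset V} (hT : Climbs (fun S => E S ≤ E y + γ) y T) :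
    green E β y m y ≤ green E β y m T + (T.card : ℝ) *
      √(2 * Fintype.card V * Real.exp (2 * β * γ) * green E β y m y) := by
  induction hT with
  | refl _ =>
    have : 0 ≤ (y.card : ℝ) *
      √(2 * Fintype.card V * Real.exp (2 * β * γ) * green E β y m y) := by positivity
    linarith
  | @step T i hT hi ih =>
    by_cases hm : i ∈ T
    · rwa [Finset.insert_eq_of_mem hm]
    · have hET : E T ≤ E y + γ := by
        cases hT with
        | refl h => exact h
        | step _ _ h => exact h
      have hmem : T ∈ (Finset.univ.erase i).powerset :=
        Finset.mem_powerset.2 fun a ha =>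
          Finset.mem_erase.2 ⟨fun h => hm (h ▸ ha), Finset.mem_univ a⟩
      have h0 : ∀ j, ∀ S : Finset V, 0 ≤ conductance E β S j *
          (green E β y m (insert j S) - green E β y m S) ^ 2 := fun j S =>
        mul_nonneg (conductance_pos E β S j).le (sq_nonneg _)
      have h1 : conductance E β T i * (green E β y m (insert i T) - green E β y m T) ^ 2 ≤
          Fintype.card V * (gibbs E β y * green E β y m y) := by
        refine le_trans ?_ (sum_dirichlet_green_le E β y m)
        refine le_trans ?_ (Finset.single_le_sum (fun j _ => Finset.sum_nonneg fun S _ => h0 j S)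
          (Finset.mem_univ i))
        exact Finset.single_le_sum (f := fun T => conductance E β T i *
          (green E β y m (insert i T) - green E β y m T) ^ 2) (fun S _ => h0 i S) hmem
      have h2 := le_conductance (S := T) (i := i) hβ hi
        (by rwa [Finset.erase_eq_of_notMem hm])
      set d := green E β y m (insert i T) - green E β y m T with hd
      -- A single edge carries at most the whole Dirichlet form, and its conductance is at least
      -- half of `exp (-2β(E y + γ))`.
      have h3 : d ^ 2 ≤ 2 * Fintype.card V * Real.exp (2 * β * γ) * green E β y m y := by
        have h4 := (mul_le_mul_of_nonneg_right h2 (sq_nonneg d)).trans h1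
        have h5 : gibbs E β y = Real.exp (-(2 * β * (E y + γ))) * Real.exp (2 * β * γ) := by
          rw [gibbs, ← Real.exp_add]; ring_nf
        rw [h5] at h4
        have h6 := Real.exp_pos (-(2 * β * (E y + γ)))
        refine le_of_mul_le_mul_left ?_ h6
        linarith
      have h7 := Real.abs_le_sqrt h3
      have h8 := neg_le_of_abs_le h7
      rw [Finset.card_insert_of_notMem hm]
      push_cast
      linarith

/-- As `g` vanishes at the full set, the climb bounds `g` by a multiple of `√g`; squaring and
dividing by `g` gives the estimate. -/
theorem green_diag_le [Nonempty V] {E : Finset V → ℝ} {β : ℝ} (hβ : 0 ≤ β) {y : Finset V}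
    {γ : ℝ} (m : ℕ) (hy : Climbs (fun S => E S ≤ E y + γ) y Finset.univ) :
    green E β y m y ≤ 2 * (Fintype.card V : ℝ) ^ 3 * Real.exp (2 * β * γ) := by
  have h := hy.green_le hβ m
  rw [green_univ, zero_add, Finset.card_univ] at h
  set g := green E β y m y
  have hg : 0 ≤ g := green_nonneg E β y m y
  have h1 : g ^ 2 ≤ (Fintype.card V : ℝ) ^ 2 *
      (2 * Fintype.card V * Real.exp (2 * β * γ) * g) := by
    have := pow_le_pow_left₀ hg h 2
    rwa [mul_pow, Real.sq_sqrt (by positivity)] at this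
  rcases hg.eq_or_lt with h0 | h0
  · rw [← h0]; positivity
  · refine le_of_mul_le_mul_right ?_ h0
    linarith

/-- The right side is the mean of `min (T, m)`, with `T` the number of updates before hitting, so
this is Markov's inequality. -/
theorem mul_one_sub_hitProb_le_sum_green [Nonempty V] (E : Finset V → ℝ) (β : ℝ) (m : ℕ)
    (S : Finset V) : m * (1 - hitProb E β m S) ≤ ∑ y, green E β y m S := by
  induction m generalizing S with
  | zero => simp [green]
  | succ m ih =>
    by_cases hu : S = Finset.univ
    · simp [hu, hitProb, green_univ]
    · have h1 : ∑ y, green E β y (m + 1) S =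
          1 + heatOp E β (fun T => ∑ y, green E β y m T) S := by
        rw [heatOp_sum]
        simp [green, hu, Finset.sum_add_distrib]
      have h2 := heatOp_mono (E := E) (β := β) ih S
      have h3 : heatOp E β (fun T => (m : ℝ) * (1 - hitProb E β m T)) S =
          m * (1 - heatOp E β (hitProb E β m) S) := by
        rw [heatOp_const_mul]
        congr 1
        have hn : (Fintype.card V : ℝ) ≠ 0 := by exact_mod_cast Fintype.card_ne_zero
        rw [eq_sub_iff_add_eq]
        unfold heatOp siteMean
        rw [← add_div, ← Finset.sum_add_distrib, div_eq_one_iff_eq hn]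
        rw [Finset.sum_congr rfl (g := fun _ => (1 : ℝ)) fun i _ => by ring]
        simp
      have h4 : hitProb E β (m + 1) S = heatOp E β (hitProb E β m) S := by
        rw [hitProb, if_neg hu]
      have h5 := hitProb_nonneg E β (m + 1) S
      rw [h1, h4] at *
      push_cast
      linarith

/-- If from every set one can climb to the full set without raising the energy by more than `γ`,
then the full set is hit after about `exp (2 * β * γ)` updates. -/
theorem mul_one_sub_hitProb_le [Nonempty V] {E : Finset V → ℝ} {β : ℝ} (hβ : 0 ≤ β) {γ : ℝ}
    (hγ : ∀ y, Climbs (fun S => E S ≤ E y + γ) y Finset.univ) (m : ℕ) (S : Finset V) :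
    m * (1 - hitProb E β m S) ≤ Fintype.card (Finset V) *
      (2 * (Fintype.card V : ℝ) ^ 3 * Real.exp (2 * β * γ)) := by
  refine (mul_one_sub_hitProb_le_sum_green E β m S).trans ?_
  refine (Finset.sum_le_card_nsmul _ _ _ fun y _ =>
    (green_le_diag E β y m S).trans (green_diag_le hβ m (hγ y))).trans_eq ?_
  simp [Finset.card_univ]

end UpperBound

/-! ### Lower bound through equilibrium flow out of a monotone family -/

section LowerBound

open scoped Classical

variable {V : Type*} [Fintype V]

/-- The probability that the dynamics in which the vertices of `A` always join leaves `Ω` within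
`m` updates. -/
def exitProb (E : Finset V → ℝ) (β : ℝ) (A : Finset V) (Ω : Set (Finset V)) :
    ℕ → Finset V → ℝ
  | 0, S => if S ∈ Ω then 0 else 1
  | m + 1, S => if S ∈ Ω then
      (∑ i, if i ∈ A then exitProb E β A Ω m (insert i S)
        else siteMean E β (exitProb E β A Ω m) S i) / Fintype.card V
      else 1

variable {E : Finset V → ℝ} {β : ℝ} {A : Finset V} {Ω : Set (Finset V)}

theorem exitProb_of_notMem (m : ℕ) {S : Finset V} (hS : S ∉ Ω) : exitProb E β A Ω m S = 1 := by
  cases m <;> simp [exitProb, hS]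

theorem exitProb_nonneg (m : ℕ) (S : Finset V) : 0 ≤ exitProb E β A Ω m S := by
  induction m generalizing S with
  | zero => unfold exitProb; split_ifs <;> norm_num
  | succ m ih =>
    unfold exitProb
    split_ifs
    · refine div_nonneg (Finset.sum_nonneg fun i _ => ?_) (by positivity)
      split_ifs
      · exact ih _
      · exact (siteMean_const E β 0 S i).symm.trans_le (siteMean_mono ih S i)
    · norm_num

theorem exitProb_le_one [Nonempty V] (m : ℕ) (S : Finset V) : exitProb E β A Ω m S ≤ 1 := by
  induction m generalizing S with
  | zero => unfold exitProb; split_ifs <;> norm_num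
  | succ m ih =>
    unfold exitProb
    split_ifs
    · rw [div_le_one (by exact_mod_cast Fintype.card_pos)]
      refine (Finset.sum_le_card_nsmul _ _ 1 fun i _ => ?_).trans_eq (by simp [Finset.card_univ])
      split_ifs
      · exact ih _
      · exact (siteMean_mono ih S i).trans_eq (siteMean_const E β 1 S i)
    · norm_num

theorem exitProb_mono [Nonempty V] (hE : ∀ S T, E (S ∪ T) + E (S ∩ T) ≤ E S + E T) (hβ : 0 ≤ β)
    (hΩ : ∀ S ∈ Ω, ∀ S' ⊆ S, S' ∈ Ω) (m : ℕ) (S T : Finset V) (hST : S ⊆ T) :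
    exitProb E β A Ω m S ≤ exitProb E β A Ω m T := by
  by_cases hT : T ∈ Ω
  · have hS := hΩ T hT S hST
    induction m generalizing S T with
    | zero => simp [exitProb, hS, hT]
    | succ m ih =>
      have ih' : ∀ S T, S ⊆ T → exitProb E β A Ω m S ≤ exitProb E β A Ω m T := by
        intro S T h
        by_cases hT : T ∈ Ω
        · exact ih S T h hT (hΩ T hT S h)
        · rw [exitProb_of_notMem m hT]
          exact exitProb_le_one m S
      rw [exitProb, exitProb, if_pos hS, if_pos hT]
      refine div_le_div_of_nonneg_right (Finset.sum_le_sum fun i _ => ?_) (by positivity)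
      split_ifs
      · exact ih' _ _ (Finset.insert_subset_insert i hST)
      · exact siteMean_le_of_monotone hE hβ ih' hST i
  · rw [exitProb_of_notMem m hT]
    exact exitProb_le_one m S

/-- The full set lies outside `Ω`, so hitting it requires an exit. Forcing `A` to join only enlarges
the set, and by attractiveness that makes exit more likely. -/
theorem hitProb_le_exitProb [Nonempty V] (hE : ∀ S T, E (S ∪ T) + E (S ∩ T) ≤ E S + E T)
    (hβ : 0 ≤ β) (hΩ : ∀ S ∈ Ω, ∀ S' ⊆ S, S' ∈ Ω) (hu : Finset.univ ∉ Ω) (m : ℕ)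
    (S : Finset V) : hitProb E β m S ≤ exitProb E β A Ω m S := by
  induction m generalizing S with
  | zero =>
    by_cases hS : S = Finset.univ
    · simp [hS, hitProb, exitProb, hu]
    · simpa [hS, hitProb] using exitProb_nonneg 0 S
  | succ m ih =>
    by_cases hS : S ∈ Ω
    · have hne : S ≠ Finset.univ := fun h => hu (h ▸ hS)
      rw [hitProb, exitProb, if_neg hne, if_pos hS]
      refine (heatOp_mono ih S).trans ?_
      refine div_le_div_of_nonneg_right (Finset.sum_le_sum fun i _ => ?_) (by positivity)
      split_ifs
      · exact siteMean_le_insert (exitProb_mono hE hβ hΩ m) S i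
      · rfl
    · rw [exitProb_of_notMem _ hS]
      exact hitProb_le_one E β _ S

/-- Started from the unnormalised equilibrium on the sets of `Ω` containing `A`, the forced chain
loses at each update at most the total flow across the boundary. Starting at equilibrium makes this
loss bound additive in `m`. -/
theorem sum_gibbs_mul_exitProb_le [Nonempty V] (hΩ : ∀ S ∈ Ω, ∀ S' ⊆ S, S' ∈ Ω) {b : ℝ}
    (hb0 : 0 ≤ b)
    (hb : ∀ S i, A ⊆ S → S ∈ Ω → insert i S ∉ Ω → conductance E β S i ≤ b) (m : ℕ) :
    ∑ S, (if A ⊆ S ∧ S ∈ Ω then gibbs E β S * exitProb E β A Ω m S else 0) ≤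
      m * (Fintype.card (Finset V) * b) := by
  induction m with
  | zero =>
    refine (Finset.sum_eq_zero fun S _ => ?_).trans_le (by simp)
    split_ifs with h
    · simp [exitProb, h.2]
    · rfl
  | succ m ih =>
    set r := exitProb E β A Ω m with hr
    have hn : (0 : ℝ) < Fintype.card V := by exact_mod_cast Fintype.card_pos
    set R := ∑ S, (if A ⊆ S ∧ S ∈ Ω then gibbs E β S * r S else 0) with hR
    have h1 : ∀ S, (if A ⊆ S ∧ S ∈ Ω then gibbs E β S * exitProb E β A Ω (m + 1) S else 0) =
        (∑ i, if A ⊆ S ∧ S ∈ Ω then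
          gibbs E β S * (if i ∈ A then r (insert i S) else siteMean E β r S i) else 0) /
            Fintype.card V := by
      intro S
      split_ifs with h
      · rw [exitProb, if_pos h.2, mul_div_assoc', Finset.mul_sum]
      · simp
    have h2 : ∀ i, ∑ S, (if A ⊆ S ∧ S ∈ Ω then
          gibbs E β S * (if i ∈ A then r (insert i S) else siteMean E β r S i) else 0) ≤
        R + Fintype.card (Finset V) * b := by
      intro i
      by_cases hi : i ∈ A
      · have h3 : ∑ S, (if A ⊆ S ∧ S ∈ Ω then
            gibbs E β S * (if i ∈ A then r (insert i S) else siteMean E β r S i) else 0) = R := by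
          refine Finset.sum_congr rfl fun S _ => ?_
          split_ifs with h
          · rw [Finset.insert_eq_of_mem (h.1 hi)]
          · rfl
        rw [h3]
        have : 0 ≤ (Fintype.card (Finset V) : ℝ) * b := by positivity
        linarith
      · simp only [hi, if_false]
        -- Pair `T` with `insert i T`. If both lie in `Ω`, detailed balance cancels the change. If
        -- only `T` does, the change is at most the conductance. The remaining case is empty because
        -- `Ω` is closed under subsets.
        rw [hR, sum_finset_eq_sum_pairs i, sum_finset_eq_sum_pairs i]
        have hcard : ((Finset.univ.erase i).powerset.card : ℝ) * b ≤
            Fintype.card (Finset V) * b :=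
          mul_le_mul_of_nonneg_right (by exact_mod_cast Finset.card_le_univ _) hb0
        refine le_trans ?_ (add_le_add_right hcard _)
        rw [← nsmul_eq_mul, ← Finset.sum_const, ← Finset.sum_add_distrib]
        refine Finset.sum_le_sum fun T hT => ?_
        have hiT := notMem_of_mem_powerset_erase hT
        have hAT : A ⊆ insert i T ↔ A ⊆ T :=
          ⟨fun h => (Finset.subset_insert_iff_of_notMem hi).1 h,
            fun h => h.trans (Finset.subset_insert i T)⟩
        simp only [hAT]
        have c1 := gibbs_mul_joinProb E β T i
        have c2 := gibbs_mul_one_sub_joinProb E β T i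
        rw [Finset.erase_eq_of_notMem hiT] at c1
        by_cases hA : A ⊆ T
        · simp only [hA, true_and]
          by_cases hTΩ : T ∈ Ω
          · by_cases hTi : insert i T ∈ Ω
            · simp only [hTΩ, hTi, if_true, siteMean, joinProb_insert E β hiT,
                Finset.insert_idem, Finset.erase_insert hiT, Finset.erase_eq_of_notMem hiT]
              have : gibbs E β T * joinProb E β T i * r (insert i T) -
                  gibbs E β T * joinProb E β T i * r T -
                  (gibbs E β (insert i T) * (1 - joinProb E β T i)) * r (insert i T) +
                  (gibbs E β (insert i T) * (1 - joinProb E β T i)) * r T = 0 := by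
                rw [c1, c2]; ring
              linarith
            · simp only [hTΩ, hTi, if_true, if_false, siteMean, Finset.erase_eq_of_notMem hiT]
              have h4 := hb T i hA hTΩ hTi
              have h5 : r (insert i T) = 1 := exitProb_of_notMem m hTi
              have h6 : 0 ≤ conductance E β T i * r T :=
                mul_nonneg (conductance_pos E β T i).le (exitProb_nonneg m T)
              rw [h5]
              rw [← c1] at h4 h6
              linarith
          · have hTi : insert i T ∉ Ω := fun h => hTΩ (hΩ _ h _ (Finset.subset_insert i T))
            simp [hTΩ, hTi, hb0]
        · simp [hA, hb0]
    simp_rw [h1]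
    rw [← Finset.sum_div, Finset.sum_comm, div_le_iff₀ hn]
    refine (Finset.sum_le_card_nsmul _ _ _ fun i _ => h2 i).trans ?_
    rw [nsmul_eq_mul, Finset.card_univ]
    push_cast
    nlinarith

/-- If leaving `Ω` with the vertices of `A` frozen requires an energy of at least `E A + δ`, then
the full set is hit from `A` only after about `exp (2 * β * δ)` updates. -/
theorem hitProb_le [Nonempty V] (hE : ∀ S T, E (S ∪ T) + E (S ∩ T) ≤ E S + E T) (hβ : 0 ≤ β)
    (hΩ : ∀ S ∈ Ω, ∀ S' ⊆ S, S' ∈ Ω) (hu : Finset.univ ∉ Ω) (hA : A ∈ Ω) {δ : ℝ}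
    (hδ : ∀ S i, A ⊆ S → S ∈ Ω → insert i S ∉ Ω → E A + δ ≤ max (E S) (E (insert i S)))
    (m : ℕ) :
    hitProb E β m A ≤ m * (Fintype.card (Finset V) * Real.exp (-(2 * β * δ))) := by
  refine (hitProb_le_exitProb (A := A) hE hβ hΩ hu m A).trans ?_
  have h1 := sum_gibbs_mul_exitProb_le (E := E) (β := β) (A := A) hΩ
    (b := gibbs E β A * Real.exp (-(2 * β * δ)))
    (mul_nonneg (gibbs_pos E β A).le (Real.exp_pos _).le) (fun S i h1 h2 h3 => by
      have hi : i ∉ S := fun h => h3 (by rwa [Finset.insert_eq_of_mem h])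
      have := hδ S i h1 h2 h3
      rw [gibbs, ← Real.exp_add]
      refine (conductance_le (c := E A + δ) hβ
        (by rwa [Finset.erase_eq_of_notMem hi])).trans_eq (by ring_nf)) m
  have h2 : gibbs E β A * exitProb E β A Ω m A ≤
      ∑ S, (if A ⊆ S ∧ S ∈ Ω then gibbs E β S * exitProb E β A Ω m S else 0) := by
    refine le_trans ?_ (Finset.single_le_sum (fun S _ => ?_) (Finset.mem_univ A))
    · rw [if_pos ⟨le_rfl, hA⟩]
    · split_ifs
      · exact mul_nonneg (gibbs_pos E β S).le (exitProb_nonneg m S)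
      · rfl
  refine le_of_mul_le_mul_left ((h2.trans h1).trans_eq ?_) (gibbs_pos E β A)
  ring

end LowerBound

/-! ### Spin configurations, energies and induced subgraphs -/

section Energies

open scoped Classical

variable {V : Type*}

/-- The number of adjacent pairs between two sets, as a real number. -/
def adjCount (G : SimpleGraph V) (A B : Finset V) : ℝ :=
  ∑ a ∈ A, ∑ b ∈ B, if G.Adj a b then (1 : ℝ) else 0

theorem adjCount_comm (G : SimpleGraph V) (A B : Finset V) :
    adjCount G A B = adjCount G B A := by
  unfold adjCount
  rw [Finset.sum_comm]
  simp only [G.adj_comm]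

theorem adjCount_union_left (G : SimpleGraph V) {A B : Finset V} (hAB : Disjoint A B)
    (C : Finset V) : adjCount G (A ∪ B) C = adjCount G A C + adjCount G B C :=
  Finset.sum_union hAB

theorem adjCount_union_right (G : SimpleGraph V) {A B : Finset V} (hAB : Disjoint A B)
    (C : Finset V) : adjCount G C (A ∪ B) = adjCount G C A + adjCount G C B := by
  rw [adjCount_comm, adjCount_union_left G hAB, adjCount_comm G A, adjCount_comm G B]

variable [Fintype V]

theorem tiltedEnergy_eq_adjCount (G : SimpleGraph V) (h : V → ℝ) (S : Finset V) :
    tiltedEnergy G h S = adjCount G S Sᶜ - ∑ i ∈ S, h i := by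
  unfold tiltedEnergy adjCount
  congr 1
  rw [← Finset.sum_product', Finset.sum_boole]
  rfl

theorem tiltedEnergy_union (G : SimpleGraph V) (h : V → ℝ) {A B : Finset V}
    (hAB : Disjoint A B) :
    tiltedEnergy G h (A ∪ B) = tiltedEnergy G h A + tiltedEnergy G h B - 2 * adjCount G A B := by
  have hA : Aᶜ = (A ∪ B)ᶜ ∪ B := by
    ext a
    have : a ∈ A → a ∉ B := fun ha => Finset.disjoint_left.1 hAB ha
    simp only [Finset.mem_compl, Finset.mem_union]
    tauto
  have hB : Bᶜ = (A ∪ B)ᶜ ∪ A := by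
    ext a
    have : a ∈ A → a ∉ B := fun ha => Finset.disjoint_left.1 hAB ha
    simp only [Finset.mem_compl, Finset.mem_union]
    tauto
  have dA : Disjoint (A ∪ B)ᶜ A := disjoint_compl_left.mono_right Finset.subset_union_left
  have dB : Disjoint (A ∪ B)ᶜ B := disjoint_compl_left.mono_right Finset.subset_union_right
  simp only [tiltedEnergy_eq_adjCount]
  rw [hA, hB, adjCount_union_left G hAB, adjCount_union_right G dA, adjCount_union_right G dB,
    Finset.sum_union hAB, adjCount_comm G B A]
  ring

/-- The set of vertices with value `+1`. -/
def plusSet (x : V → ℤˣ) : Finset V := Finset.univ.filter fun i => x i = 1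

theorem mem_plusSet {x : V → ℤˣ} {i : V} : i ∈ plusSet x ↔ x i = 1 := by simp [plusSet]

theorem plusSet_eq_univ {x : V → ℤˣ} : plusSet x = Finset.univ ↔ x = fun _ => 1 := by
  rw [Finset.eq_univ_iff_forall, funext_iff]
  simp only [mem_plusSet]

theorem localField_eq (G : SimpleGraph V) (h : V → ℝ) (x : V → ℤˣ) (i : V) :
    localField G h x i =
      tiltedEnergy G h ((plusSet x).erase i) - tiltedEnergy G h (insert i (plusSet x)) := by
  set T := (plusSet x).erase i with hT
  have hd : Disjoint T {i} := Finset.disjoint_singleton_right.2 (Finset.notMem_erase i _)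
  have hins : insert i (plusSet x) = T ∪ {i} := by
    ext a
    simp only [hT, Finset.mem_insert, Finset.mem_union, Finset.mem_erase, Finset.mem_singleton]
    tauto
  rw [hins, tiltedEnergy_union G h hd]
  have h1 : tiltedEnergy G h {i} = (∑ j ∈ G.neighborFinset i, (1 : ℝ)) - h i := by
    rw [tiltedEnergy_eq_adjCount]
    simp only [adjCount, Finset.sum_singleton]
    rw [Finset.sum_boole, ← Nat.smul_one_eq_cast, ← Finset.sum_const]
    congr 2
    ext j
    simp only [Finset.mem_filter, Finset.mem_compl, Finset.mem_singleton,
      SimpleGraph.mem_neighborFinset, and_iff_right_iff_imp]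
    intro hj hji
    exact G.ne_of_adj hj hji.symm
  have h2 : adjCount G T {i} = ∑ j ∈ G.neighborFinset i, if x j = 1 then (1 : ℝ) else 0 := by
    rw [adjCount_comm]
    simp only [adjCount, Finset.sum_singleton]
    rw [Finset.sum_boole, Finset.sum_boole]
    congr 2
    ext j
    simp only [hT, Finset.mem_filter, Finset.mem_erase, mem_plusSet,
      SimpleGraph.mem_neighborFinset]
    constructor
    · rintro ⟨⟨-, h2⟩, h3⟩; exact ⟨h3, h2⟩
    · rintro ⟨h3, h2⟩; exact ⟨⟨(G.ne_of_adj h3).symm, h2⟩, h3⟩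
  have h3 : ∑ j ∈ G.neighborFinset i, ((x j : ℤ) : ℝ) =
      2 * (∑ j ∈ G.neighborFinset i, if x j = 1 then (1 : ℝ) else 0) -
        ∑ j ∈ G.neighborFinset i, (1 : ℝ) := by
    rw [Finset.mul_sum, ← Finset.sum_sub_distrib]
    refine Finset.sum_congr rfl fun j _ => ?_
    rcases Int.units_eq_one_or (x j) with hx | hx
    · simp [hx]; norm_num
    · have : ¬ ((-1 : ℤˣ) = 1) := by decide
      simp [hx, this]
  rw [localField, h1, h2, h3]
  ring

theorem heatBath_one_eq (G : SimpleGraph V) (h : V → ℝ) (β : ℝ) (x : V → ℤˣ) (i : V) :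
    heatBath G h β x i 1 = joinProb (tiltedEnergy G h) β (plusSet x) i := by
  unfold heatBath joinProb
  rw [localField_eq]
  congr 3
  push_cast
  ring

theorem plusSet_update (G : SimpleGraph V) (h : V → ℝ) (β : ℝ) (x : V → ℤˣ) (i : V)
    (u : unitInterval) : plusSet (update G h β x i u) =
      if (u : ℝ) ≤ joinProb (tiltedEnergy G h) β (plusSet x) i then insert i (plusSet x)
      else (plusSet x).erase i := by
  unfold update
  rw [heatBath_one_eq]
  have h1 : ¬ ((-1 : ℤˣ) = 1) := by decide
  ext j
  split_ifs with hu <;> by_cases hj : j = i <;>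
    simp [mem_plusSet, hj, h1]

/-- The set of all vertices that are outside `F` or belong to `S`. -/
def extendSet (F : Set V) (S : Finset F) : Finset V :=
  (Finset.univ.filter fun i => i ∉ F) ∪ S.map (Function.Embedding.subtype _)

theorem mem_extendSet {F : Set V} {S : Finset F} {i : V} :
    i ∈ extendSet F S ↔ ∀ hi : i ∈ F, (⟨i, hi⟩ : F) ∈ S := by
  simp only [extendSet, Finset.mem_union, Finset.mem_filter, Finset.mem_univ, true_and,
    Finset.mem_map, Function.Embedding.subtype_apply, Subtype.exists, exists_and_right,
    exists_eq_right]
  by_cases hi : i ∈ F <;> simp [hi]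

/-- The edges between `S` and the outside of `F` leave the cut when the outside is already plus. The
extra term in the induced field records exactly this gain. -/
theorem tiltedEnergy_induce (G : SimpleGraph V) (h : V → ℝ) (F : Set V) (S : Finset F) :
    tiltedEnergy G h (extendSet F S) = tiltedEnergy G h (extendSet F ∅) +
      tiltedEnergy (G.induce F) (inducedField G h F) S := by
  set A : Finset V := Finset.univ.filter fun i => i ∉ F with hA
  set B : Finset V := S.map (Function.Embedding.subtype _) with hB
  have h0 : extendSet F (∅ : Finset F) = A := by simp [extendSet, hA]
  have hBF : ∀ b ∈ B, b ∈ F := by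
    intro b hb
    obtain ⟨c, -, rfl⟩ := Finset.mem_map.1 hb
    exact c.2
  have hd : Disjoint A B := by
    rw [Finset.disjoint_left]
    intro a ha hb
    exact (Finset.mem_filter.1 ha).2 (hBF a hb)
  have hc : Bᶜ = A ∪ Sᶜ.map (Function.Embedding.subtype _) := by
    ext a
    simp only [hA, hB, Finset.mem_compl, Finset.mem_union, Finset.mem_filter, Finset.mem_univ,
      true_and, Finset.mem_map, Function.Embedding.subtype_apply, Subtype.exists,
      exists_and_right, exists_eq_right]
    by_cases ha : a ∈ F <;> simp [ha]
  have hd2 : Disjoint A (Sᶜ.map (Function.Embedding.subtype _)) := by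
    rw [Finset.disjoint_left]
    intro a ha hb
    obtain ⟨c, -, rfl⟩ := Finset.mem_map.1 hb
    exact (Finset.mem_filter.1 ha).2 c.2
  have h1 : tiltedEnergy (G.induce F) (inducedField G h F) S =
      adjCount G B (Sᶜ.map (Function.Embedding.subtype _)) - ∑ i ∈ B, h i - adjCount G B A := by
    rw [tiltedEnergy_eq_adjCount]
    unfold adjCount inducedField
    rw [Finset.sum_add_distrib, hB, Finset.sum_map, Finset.sum_map, Finset.sum_map, ← sub_sub]
    congr 1
    · congr 1
      refine Finset.sum_congr rfl fun a _ => ?_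
      rw [Finset.sum_map]
      exact Finset.sum_congr (by ext; simp) fun b _ => if_congr (by simp) rfl rfl
    · refine Finset.sum_congr rfl fun a _ => ?_
      rw [Finset.sum_boole]
      congr 2
      ext j
      simp only [hA, Finset.mem_filter, Finset.mem_univ, true_and,
        Function.Embedding.subtype_apply, and_comm]
  rw [h0, h1, show extendSet F S = A ∪ B from rfl, tiltedEnergy_union G h hd,
    tiltedEnergy_eq_adjCount G h B, hc, adjCount_union_right G hd2, adjCount_comm G A B]
  ring

theorem le_maxTiltedCutwidth (G : SimpleGraph V) (h : V → ℝ) {F : Set V} (hF : F.Nonempty) :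
    tiltedCutwidth (G.induce F) (inducedField G h F) ≤ maxTiltedCutwidth G h :=
  le_ciSup (f := fun F : {F : Set V // F.Nonempty} =>
    tiltedCutwidth (G.induce F.1) (inducedField G h F.1)) (Set.finite_range _).bddAbove ⟨F, hF⟩

theorem maxTiltedCutwidth_nonneg [Nonempty V] (G : SimpleGraph V) (h : V → ℝ) :
    0 ≤ maxTiltedCutwidth G h := by
  obtain ⟨F, hF⟩ : ∃ F : Set V, F.Nonempty := ⟨_, Set.univ_nonempty⟩
  have : Nonempty F := hF.to_subtype
  refine le_trans ?_ (le_maxTiltedCutwidth G h hF)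
  rw [← tiltedCut_eq_tiltedCutwidth]
  exact tiltedCut_nonneg _ _

/-- From every set one can climb to the full set without raising the energy by more than the
maximal tilted cutwidth. -/
theorem climbs_univ [Nonempty V] (G : SimpleGraph V) (h : V → ℝ) (y : Finset V) :
    Climbs (fun S => tiltedEnergy G h S ≤ tiltedEnergy G h y + maxTiltedCutwidth G h) y
      Finset.univ := by
  by_cases hy : y = Finset.univ
  · rw [hy]
    exact .refl (by linarith [maxTiltedCutwidth_nonneg G h])
  · obtain ⟨F, hF⟩ : ∃ F : Set V, ∀ i, i ∈ F ↔ i ∉ y := ⟨{i | i ∉ y}, fun _ => Iff.rfl⟩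
    have hne : F.Nonempty := by
      by_contra hcon
      refine hy (Finset.eq_univ_iff_forall.2 fun i => ?_)
      by_contra hi
      exact hcon ⟨i, (hF i).2 hi⟩
    obtain ⟨σ, hσ⟩ := exists_ordering_le_tiltedCutwidth (G.induce F) (inducedField G h F)
    have h0 : extendSet F ∅ = y := by
      ext i
      simp [mem_extendSet, hF]
    have hle : ∀ t ≤ Fintype.card F, tiltedEnergy G h (extendSet F (initialSet σ t)) ≤
        tiltedEnergy G h y + maxTiltedCutwidth G h := by
      intro t ht
      rw [tiltedEnergy_induce, h0]
      linarith [hσ t ht, le_maxTiltedCutwidth G h hne]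
    have hcl : ∀ t ≤ Fintype.card F,
        Climbs (fun S => tiltedEnergy G h S ≤ tiltedEnergy G h y + maxTiltedCutwidth G h) y
          (extendSet F (initialSet σ t)) := by
      intro t
      induction t with
      | zero =>
        intro ht
        have := hle 0 ht
        rw [initialSet_zero, h0] at this ⊢
        exact .refl this
      | succ t ih =>
        intro ht
        have := hle (t + 1) ht
        have hs : extendSet F (initialSet σ (t + 1)) =
            insert (σ ⟨t, by omega⟩ : V) (extendSet F (initialSet σ t)) := by
          rw [initialSet_succ σ (by omega)]
          ext j
          simp only [mem_extendSet, Finset.mem_insert]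
          by_cases hj : j ∈ F
          · simp [hj, Subtype.ext_iff]
          · simp [hj]
        rw [hs] at this ⊢
        exact (ih (by omega)).step _ this
    have := hcl _ le_rfl
    rw [initialSet_card] at this
    convert this using 1
    ext i
    simp [mem_extendSet]

/-- A set `A` and a monotone family that realise the maximal tilted cut. -/
theorem exists_barrier [Nonempty V] (G : SimpleGraph V) (h : V → ℝ) :
    ∃ (A : Finset V) (Ω : Set (Finset V)), (∀ S ∈ Ω, ∀ S' ⊆ S, S' ∈ Ω) ∧
      Finset.univ ∉ Ω ∧ A ∈ Ω ∧ ∀ S i, A ⊆ S → S ∈ Ω → insert i S ∉ Ω →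
        tiltedEnergy G h A + maxTiltedCut G h ≤
          max (tiltedEnergy G h S) (tiltedEnergy G h (insert i S)) := by
  have hne : Nonempty {F : Set V // F.Nonempty} := ⟨⟨_, Set.univ_nonempty⟩⟩
  obtain ⟨F, hF⟩ := exists_eq_ciSup_of_finite (f := fun F : {F : Set V // F.Nonempty} =>
    tiltedCut (G.induce F.1) (inducedField G h F.1))
  obtain ⟨F, hFne⟩ := F
  have : Nonempty F := hFne.to_subtype
  obtain ⟨Ω, hΩ, hle⟩ := exists_tiltedCut_le (G.induce F) (inducedField G h F)
  have hmem : ∀ S : Finset V, extendSet F ∅ ⊆ S → extendSet F (S.subtype (· ∈ F)) = S := by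
    intro S hS
    ext i
    by_cases hi : i ∈ F
    · simp [mem_extendSet, hi]
    · have : i ∈ S := hS (mem_extendSet.2 fun h => absurd h hi)
      simp [mem_extendSet, hi, this]
  refine ⟨extendSet F ∅, {S | S.subtype (· ∈ F) ∈ Ω}, ?_, ?_, ?_, ?_⟩
  · intro S hS S' hS'
    exact hΩ.2.2 _ hS _ (Finset.subtype_mono hS')
  · intro hu
    refine hΩ.2.1 ?_
    have h1 : (Finset.univ : Finset V).subtype (· ∈ F) = Finset.univ := by
      ext i
      simp
    exact h1 ▸ hu
  · change (extendSet F ∅).subtype (· ∈ F) ∈ Ω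
    have h1 : (extendSet F ∅).subtype (· ∈ F) = ∅ := by
      ext i
      simp [mem_extendSet]
    rw [h1]
    exact hΩ.1
  · intro S i hS hSΩ hiΩ
    have hi : i ∈ F := by
      by_contra hi
      have : i ∈ S := hS (mem_extendSet.2 fun h => absurd h hi)
      rw [Finset.insert_eq_of_mem this] at hiΩ
      exact hiΩ hSΩ
    have h1 := hle (S.subtype (· ∈ F), (insert i S).subtype (· ∈ F))
      ⟨hSΩ, hiΩ, ⟨i, hi⟩, by ext j; simp [Subtype.ext_iff]⟩
    have h2 := tiltedEnergy_induce G h F (S.subtype (· ∈ F))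
    have h3 := tiltedEnergy_induce G h F ((insert i S).subtype (· ∈ F))
    rw [hmem S hS] at h2
    rw [hmem _ (hS.trans (Finset.subset_insert i S))] at h3
    rw [h2, h3, max_add_add_left]
    have h4 : maxTiltedCut G h = tiltedCut (G.induce F) (inducedField G h F) := hF.symm
    rw [h4]
    exact add_le_add_right h1 _

end Energies

/-! ### Recursions driven by independent variables -/

section DrivenRecursion

variable {X A : Type*}

/-- The recursion `a ↦ step a x` driven by the sequence `ω`. -/
def drive (step : A → X → A) (a : A) (ω : ℕ → X) : ℕ → A
  | 0 => a
  | m + 1 => step (drive step a ω m) (ω m)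

theorem drive_congr (step : A → X → A) (a : A) {ω ω' : ℕ → X} {m : ℕ}
    (h : ∀ k < m, ω k = ω' k) : drive step a ω m = drive step a ω' m := by
  induction m with
  | zero => rfl
  | succ m ih =>
    rw [drive, drive, ih fun k hk => h k (by omega), h m (by omega)]

theorem ringTime_eq_drive {V : Type*} (ω : ℕ → Ring V) (m : ℕ) :
    ringTime ω m = drive (fun a r => a + r.1) (0 : ℝ) ω m := by
  induction m with
  | zero => simp [ringTime, drive]
  | succ m ih => rw [drive, ← ih, ringTime, Finset.sum_range_succ, ringTime]

variable [MeasurableSpace X] [MeasurableSpace A] {step : A → X → A}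

theorem measurable_drive (hstep : Measurable (Function.uncurry step)) (a : A) (m : ℕ) :
    Measurable fun ω : ℕ → X => drive step a ω m := by
  induction m with
  | zero => exact measurable_const
  | succ m ih => exact hstep.comp (ih.prodMk (measurable_pi_apply m))

/-- The position after `m` steps is independent of the next driving variable. -/
theorem lintegral_drive_succ (ν : Measure X) [IsProbabilityMeasure ν]
    (hstep : Measurable (Function.uncurry step)) (a : A) (m : ℕ) {f : A → ℝ≥0∞}
    (hf : Measurable f) :
    ∫⁻ ω, f (drive step a ω (m + 1)) ∂(Measure.infinitePi fun _ : ℕ => ν) =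
      ∫⁻ ω, ∫⁻ x, f (step (drive step a ω m) x) ∂ν ∂(Measure.infinitePi fun _ : ℕ => ν) := by
  set P := Measure.infinitePi fun _ : ℕ => ν with hP
  obtain ⟨x0⟩ : Nonempty X := nonempty_of_isProbabilityMeasure ν
  have hmd := measurable_drive hstep a m
  have hind : ProbabilityTheory.IndepFun (fun ω : ℕ → X => drive step a ω m) (fun ω => ω m) P := by
    have h1 : ProbabilityTheory.iIndepFun (fun i (ω : ℕ → X) => ω i) P :=
      ProbabilityTheory.iIndepFun_infinitePi (X := fun _ x => x) fun _ => measurable_id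
    have h2 := h1.indepFun_finset (Finset.range m) {m} (by simp) fun i => measurable_pi_apply i
    -- The first `m` driving variables determine the position, so it factors through their
    -- restriction; the filler `x0` is never read.
    let ext : (Finset.range m → X) → ℕ → X := fun y k =>
      if hk : k ∈ Finset.range m then y ⟨k, hk⟩ else x0
    have hext : Measurable ext := by
      refine measurable_pi_iff.2 fun k => ?_
      by_cases hk : k ∈ Finset.range m
      · simp only [ext, hk, dif_pos]
        exact measurable_pi_apply _
      · simp only [ext, hk, dif_neg, not_false_eq_true]
        exact measurable_const
    have h3 := h2.comp (hmd.comp hext)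
      (measurable_pi_apply (⟨m, Finset.mem_singleton_self m⟩ : ({m} : Finset ℕ)))
    have h4 : (fun ω : ℕ → X => drive step a ω m) =
        ((fun ω => drive step a ω m) ∘ ext) ∘ fun ω i => ω i := by
      funext ω
      refine drive_congr step a fun k hk => ?_
      simp [ext, hk]
    rw [h4]
    exact h3
  have hlaw : P.map (fun ω => (drive step a ω m, ω m)) =
      (P.map fun ω => drive step a ω m).prod ν := by
    rw [(ProbabilityTheory.indepFun_iff_map_prod_eq_prod_map_map hmd.aemeasurable
      (measurable_pi_apply m).aemeasurable).1 hind]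
    congr 1
    exact Measure.infinitePi_map_eval (fun _ : ℕ => ν) m
  have hfs : Measurable fun p : A × X => f (step p.1 p.2) := hf.comp hstep
  calc ∫⁻ ω, f (drive step a ω (m + 1)) ∂P
      = ∫⁻ p, f (step p.1 p.2) ∂(P.map fun ω => (drive step a ω m, ω m)) := by
        rw [lintegral_map hfs (hmd.prodMk (measurable_pi_apply m))]
        rfl
    _ = ∫⁻ b, ∫⁻ x, f (step b x) ∂ν ∂(P.map fun ω => drive step a ω m) := by
        rw [hlaw, lintegral_prod _ hfs.aemeasurable]
    _ = _ := by
        rw [lintegral_map hfs.lintegral_prod_right' hmd]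

end DrivenRecursion

/-! ### Tail bounds for the ring times -/

section WaitingTimes

open ProbabilityTheory

variable {V : Type*} [Fintype V] [Nonempty V] [MeasurableSpace V] [MeasurableSingletonClass V]

instance isProbabilityMeasure_clockLaw : IsProbabilityMeasure (clockLaw V) := by
  unfold clockLaw
  infer_instance

theorem card_pos_real (V : Type*) [Fintype V] [Nonempty V] : (0 : ℝ) < Fintype.card V := by
  exact_mod_cast Fintype.card_pos

theorem measurePreserving_fst_ringLaw :
    MeasurePreserving Prod.fst (ringLaw V) (expMeasure (Fintype.card V)) := by
  have : IsProbabilityMeasure (expMeasure (Fintype.card V)) :=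
    isProbabilityMeasure_expMeasure (card_pos_real V)
  have : IsProbabilityMeasure (uniformOn (Set.univ : Set V)) :=
    isProbabilityMeasure_uniformOn Set.finite_univ Set.univ_nonempty
  exact measurePreserving_fst

theorem measurePreserving_wait (k : ℕ) :
    MeasurePreserving (fun ω : ℕ → Ring V => (ω k).1) (clockLaw V)
      (expMeasure (Fintype.card V)) :=
  measurePreserving_fst_ringLaw.comp (measurePreserving_eval_infinitePi (fun _ => ringLaw V) k)

theorem expMeasure_Iic {r : ℝ} (hr : 0 < r) {x : ℝ} (hx : 0 ≤ x) :
    expMeasure r (Set.Iic x) = ENNReal.ofReal (1 - Real.exp (-(r * x))) := by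
  have := isProbabilityMeasure_expMeasure hr
  rw [← ofReal_cdf, cdf_expMeasure_eq hr, if_pos hx]

theorem expMeasure_Ioi {r : ℝ} (hr : 0 < r) {x : ℝ} (hx : 0 ≤ x) :
    expMeasure r (Set.Ioi x) = ENNReal.ofReal (Real.exp (-(r * x))) := by
  have := isProbabilityMeasure_expMeasure hr
  rw [← Set.compl_Iic, prob_compl_eq_one_sub measurableSet_Iic, expMeasure_Iic hr hx,
    ← ENNReal.ofReal_one, ← ENNReal.ofReal_sub _
      (sub_nonneg.2 (Real.exp_le_one_iff.2 (by nlinarith)))]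
  congr 1
  ring

theorem ae_expMeasure_pos {r : ℝ} (hr : 0 < r) : ∀ᵐ x ∂expMeasure r, 0 < x := by
  have h := expMeasure_Iic hr le_rfl
  rw [mul_zero, neg_zero, Real.exp_zero, sub_self, ENNReal.ofReal_zero] at h
  rw [ae_iff]
  simp only [not_lt]
  exact h

theorem lintegral_ofReal_expMeasure_lt_top {r : ℝ} (hr : 0 < r) :
    ∫⁻ x, ENNReal.ofReal x ∂expMeasure r < ⊤ := by
  rw [lintegral_eq_lintegral_meas_lt _ ((ae_expMeasure_pos hr).mono fun x hx => hx.le)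
    aemeasurable_id]
  change ∫⁻ t in Set.Ioi 0, expMeasure r (Set.Ioi t) < ⊤
  rw [setLIntegral_congr_fun (g := fun t => ENNReal.ofReal (Real.exp (-(r * t))))
    measurableSet_Ioi (fun t (ht : 0 < t) => expMeasure_Ioi hr ht.le)]
  have := (exp_neg_integrableOn_Ioi 0 hr).lintegral_lt_top
  simpa only [neg_mul] using this

theorem lintegral_exp_neg_expMeasure_lt_one {r : ℝ} (hr : 0 < r) :
    ∫⁻ x, ENNReal.ofReal (Real.exp (-x)) ∂expMeasure r < 1 := by
  have := isProbabilityMeasure_expMeasure hr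
  have hlt : ∀ᵐ x ∂expMeasure r, ENNReal.ofReal (Real.exp (-x)) < 1 := by
    filter_upwards [ae_expMeasure_pos hr] with x hx
    rw [← ENNReal.ofReal_one, ENNReal.ofReal_lt_ofReal_iff one_pos]
    exact Real.exp_lt_one_iff.2 (by linarith)
  have hle : ∫⁻ x, ENNReal.ofReal (Real.exp (-x)) ∂expMeasure r ≤ ∫⁻ _, 1 ∂expMeasure r :=
    lintegral_mono_ae (hlt.mono fun x hx => hx.le)
  refine (lintegral_strict_mono (IsProbabilityMeasure.ne_zero _) aemeasurable_const
    (ne_top_of_le_ne_top (by simp) hle) hlt).trans_eq (by simp)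

theorem ae_wait_pos : ∀ᵐ ω ∂clockLaw V, ∀ k, 0 < (ω k).1 := by
  rw [ae_all_iff]
  intro k
  exact (measurePreserving_wait k).quasiMeasurePreserving.ae (ae_expMeasure_pos (card_pos_real V))

/-- Lower tail of the ring times. -/
theorem exists_clockLaw_ringTime_le (V : Type*) [Fintype V] [Nonempty V] [MeasurableSpace V]
    [MeasurableSingletonClass V] : ∃ ρ : ℝ, 0 < ρ ∧ ρ < 1 ∧ ∀ (m : ℕ) (t : ℝ),
      clockLaw V {ω | ringTime ω m ≤ t} ≤ ENNReal.ofReal (Real.exp t * ρ ^ m) := by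
  set κ := ∫⁻ x, ENNReal.ofReal (Real.exp (-x)) ∂expMeasure (Fintype.card V) with hκ
  have hκ1 : κ < 1 := lintegral_exp_neg_expMeasure_lt_one (card_pos_real V)
  have hfm : Measurable fun x : ℝ => ENNReal.ofReal (Real.exp (-x)) := by fun_prop
  have hmean : ∀ m, ∫⁻ ω, ENNReal.ofReal (Real.exp (-ringTime ω m)) ∂clockLaw V = κ ^ m := by
    intro m
    simp only [ringTime_eq_drive]
    induction m with
    | zero => simp [drive]
    | succ m ih =>
      rw [clockLaw, lintegral_drive_succ (ringLaw V) (by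
        change Measurable fun p : ℝ × Ring V => p.1 + p.2.1
        fun_prop) _ _ hfm, pow_succ, ← ih, clockLaw]
      rw [← lintegral_mul_const' _ _ hκ1.ne_top]
      refine lintegral_congr fun ω => ?_
      have : ∀ r : Ring V, ENNReal.ofReal
          (Real.exp (-(drive (fun a (r : Ring V) => a + r.1) (0 : ℝ) ω m + r.1))) =
          ENNReal.ofReal (Real.exp (-drive (fun a (r : Ring V) => a + r.1) (0 : ℝ) ω m)) *
            ENNReal.ofReal (Real.exp (-r.1)) := by
        intro r
        rw [neg_add, Real.exp_add, ENNReal.ofReal_mul (Real.exp_pos _).le]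
      simp only [this]
      rw [lintegral_const_mul' _ _ ENNReal.ofReal_ne_top,
        measurePreserving_fst_ringLaw.lintegral_comp hfm]
  -- The maximum with `1 / 2` supplies positivity, needed later for `Real.log ρ`, without examining
  -- `κ`. The bound is Markov's inequality for `exp (-ringTime)`.
  refine ⟨max κ.toReal (1 / 2), by positivity, ?_, fun m t => ?_⟩
  · refine max_lt ?_ (by norm_num)
    rw [← ENNReal.toReal_one]
    exact (ENNReal.toReal_lt_toReal hκ1.ne_top ENNReal.one_ne_top).2 hκ1
  · have hmeas : Measurable fun ω : ℕ → Ring V => ringTime ω m := by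
      unfold ringTime
      fun_prop
    have h1 := mul_meas_ge_le_lintegral (μ := clockLaw V) (hfm.comp hmeas)
      (ENNReal.ofReal (Real.exp (-t)))
    simp only [Function.comp_def] at h1
    rw [hmean] at h1
    have h2 : {ω : ℕ → Ring V | ringTime ω m ≤ t} ⊆ {ω | ENNReal.ofReal (Real.exp (-t)) ≤
        ENNReal.ofReal (Real.exp (-ringTime ω m))} := by
      intro ω hω
      exact ENNReal.ofReal_le_ofReal (Real.exp_le_exp.2 (neg_le_neg hω))
    calc clockLaw V {ω | ringTime ω m ≤ t}
        = ENNReal.ofReal (Real.exp t) * (ENNReal.ofReal (Real.exp (-t)) *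
            clockLaw V {ω | ringTime ω m ≤ t}) := by
          rw [← mul_assoc, ← ENNReal.ofReal_mul (Real.exp_pos t).le, ← Real.exp_add]
          simp
      _ ≤ ENNReal.ofReal (Real.exp t) * κ ^ m := by
          gcongr
          exact le_trans (by gcongr) h1
      _ ≤ ENNReal.ofReal (Real.exp t) * ENNReal.ofReal (max κ.toReal (1 / 2)) ^ m := by
          gcongr
          exact (ENNReal.le_ofReal_iff_toReal_le hκ1.ne_top (by positivity)).2 (le_max_left _ _)
      _ = _ := by
          rw [← ENNReal.ofReal_pow (by positivity), ← ENNReal.ofReal_mul (Real.exp_pos t).le]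

/-- Upper tail of the ring times. -/
theorem exists_clockLaw_le_ringTime (V : Type*) [Fintype V] [Nonempty V] [MeasurableSpace V]
    [MeasurableSingletonClass V] : ∃ C : ℝ, 0 < C ∧ ∀ (m : ℕ) (t : ℝ), 0 < t →
      clockLaw V {ω | t ≤ ringTime ω m} ≤ ENNReal.ofReal (C * m / t) := by
  set κ := ∫⁻ x, ENNReal.ofReal x ∂expMeasure (Fintype.card V) with hκ
  have hκ1 : κ < ⊤ := lintegral_ofReal_expMeasure_lt_top (card_pos_real V)
  refine ⟨κ.toReal + 1, by positivity, fun m t ht => ?_⟩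
  have hmean : ∫⁻ ω, ∑ k ∈ Finset.range m, ENNReal.ofReal (ω k).1 ∂clockLaw V = m * κ := by
    rw [lintegral_finsetSum _ (fun k _ => by fun_prop)]
    rw [Finset.sum_congr rfl fun k _ => (measurePreserving_wait (V := V) k).lintegral_comp
      ENNReal.measurable_ofReal]
    simp [hκ]
  have h1 := mul_meas_ge_le_lintegral (μ := clockLaw V)
    (f := fun ω => ∑ k ∈ Finset.range m, ENNReal.ofReal (ω k).1) (by fun_prop) (ENNReal.ofReal t)
  rw [hmean] at h1
  have h2 : {ω : ℕ → Ring V | t ≤ ringTime ω m} ≤ᵐ[clockLaw V]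
      {ω | ENNReal.ofReal t ≤ ∑ k ∈ Finset.range m, ENNReal.ofReal (ω k).1} := by
    filter_upwards [ae_wait_pos (V := V)] with ω hω hωt
    change ENNReal.ofReal t ≤ ∑ k ∈ Finset.range m, ENNReal.ofReal (ω k).1
    rw [← ENNReal.ofReal_sum_of_nonneg fun k _ => (hω k).le]
    exact ENNReal.ofReal_le_ofReal hωt
  refine (measure_mono_ae h2).trans ?_
  have ht0 : ENNReal.ofReal t ≠ 0 := by simpa using ht
  rw [mul_comm, ← ENNReal.le_div_iff_mul_le (Or.inl ht0) (Or.inl ENNReal.ofReal_ne_top)] at h1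
  refine h1.trans ?_
  rw [ENNReal.ofReal_div_of_pos ht]
  gcongr
  rw [mul_comm, ENNReal.ofReal_mul (by positivity), ENNReal.ofReal_natCast]
  gcongr
  exact (ENNReal.le_ofReal_iff_toReal_le hκ1.ne (by positivity)).2 (by linarith)

end WaitingTimes

/-! ### The jump chain stopped at the full set -/

section StoppedChain

open scoped Classical
open ProbabilityTheory

variable {V : Type*} [Fintype V]

instance measurableSpaceFinset : MeasurableSpace (Finset V) := ⊤

instance discreteMeasurableSpaceFinset : DiscreteMeasurableSpace (Finset V) :=
  ⟨fun _ => trivial⟩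

/-- One ring of the dynamics on sets of vertices, stopped at the full set. -/
def stoppedStep (E : Finset V → ℝ) (β : ℝ) (S : Finset V) (r : Ring V) : Finset V :=
  if S = Finset.univ then S
  else if (r.2.2 : ℝ) ≤ joinProb E β S r.2.1 then insert r.2.1 S else S.erase r.2.1

theorem drive_stoppedStep_eq_univ_of_le {E : Finset V → ℝ} {β : ℝ} {S : Finset V}
    {ω : ℕ → Ring V} {k m : ℕ} (hkm : k ≤ m)
    (hk : drive (stoppedStep E β) S ω k = Finset.univ) :
    drive (stoppedStep E β) S ω m = Finset.univ := by
  induction m, hkm using Nat.le_induction with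
  | base => exact hk
  | succ m _ ih => rw [drive, ih, stoppedStep, if_pos rfl]

/-- The stopped chain follows the dynamics until the full set is hit. -/
theorem drive_stoppedStep_eq (G : SimpleGraph V) (h : V → ℝ) (β : ℝ) (x : V → ℤˣ)
    (ω : ℕ → Ring V) (m : ℕ) (hm : ∀ k < m, plusSet (afterRings G h β x ω k) ≠ Finset.univ) :
    drive (stoppedStep (tiltedEnergy G h) β) (plusSet x) ω m =
      plusSet (afterRings G h β x ω m) := by
  induction m with
  | zero => rfl
  | succ m ih =>
    rw [drive, ih fun k hk => hm k (by omega), afterRings, plusSet_update, stoppedStep,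
      if_neg (hm m (by omega))]

theorem drive_stoppedStep_eq_univ_iff (G : SimpleGraph V) (h : V → ℝ) (β : ℝ) (x : V → ℤˣ)
    (ω : ℕ → Ring V) (m : ℕ) :
    drive (stoppedStep (tiltedEnergy G h) β) (plusSet x) ω m = Finset.univ ↔
      ∃ k ≤ m, afterRings G h β x ω k = fun _ => 1 := by
  simp only [← plusSet_eq_univ]
  constructor
  · intro hm
    by_contra! hcon
    rw [drive_stoppedStep_eq G h β x ω m fun k hk => hcon k hk.le] at hm
    exact hcon m le_rfl hm
  · intro hex
    -- Use the first hitting index: up to it the stopped chain agrees with the dynamics, and from it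
    -- on the chain stays at the full set.
    obtain ⟨hle, hk⟩ := Nat.find_spec hex
    refine drive_stoppedStep_eq_univ_of_le hle ?_
    rw [drive_stoppedStep_eq G h β x ω _ fun j hj hju => ?_, hk]
    exact Nat.find_min hex hj ⟨by omega, hju⟩

variable [MeasurableSpace V] [MeasurableSingletonClass V]

theorem measurable_stoppedStep (E : Finset V → ℝ) (β : ℝ) :
    Measurable (Function.uncurry (stoppedStep E β)) := by
  refine measurable_from_prod_countable_right fun S => ?_
  have h1 : Measurable fun p : V × unitInterval =>
      if S = Finset.univ then S
      else if (p.2 : ℝ) ≤ joinProb E β S p.1 then insert p.1 S else S.erase p.1 := by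
    refine measurable_from_prod_countable_right fun i => ?_
    have h2 : Measurable fun u : unitInterval =>
        if (u : ℝ) ≤ joinProb E β S i then insert i S else S.erase i :=
      Measurable.ite (measurableSet_le measurable_subtype_coe measurable_const)
        measurable_const measurable_const
    exact Measurable.ite (MeasurableSet.const _) measurable_const h2
  exact h1.comp measurable_snd

theorem lintegral_ite_le {q : ℝ} (hq0 : 0 ≤ q) (hq1 : q ≤ 1) (a b : ℝ≥0∞) :
    ∫⁻ u : unitInterval, (if (u : ℝ) ≤ q then a else b) =
      ENNReal.ofReal q * a + ENNReal.ofReal (1 - q) * b := by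
  have h1 : MeasurableSet {u : unitInterval | (u : ℝ) ≤ q} :=
    measurableSet_le measurable_subtype_coe measurable_const
  have h2 : volume {u : unitInterval | (u : ℝ) ≤ q} = ENNReal.ofReal q :=
    unitInterval.volume_Iic ⟨q, hq0, hq1⟩
  have h3 : (fun u : unitInterval => if (u : ℝ) ≤ q then a else b) =
      ({u : unitInterval | (u : ℝ) ≤ q}).piecewise (fun _ => a) fun _ => b := by
    funext u
    simp [Set.piecewise]
  rw [h3, lintegral_piecewise h1, setLIntegral_const, setLIntegral_const,
    prob_compl_eq_one_sub h1, h2, ← ENNReal.ofReal_one, ← ENNReal.ofReal_sub _ hq0,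
    mul_comm a, mul_comm b]

variable [Nonempty V]

theorem lintegral_ringLaw (E : Finset V → ℝ) (β : ℝ) {φ : Finset V → ℝ} (hφ : ∀ S, 0 ≤ φ S)
    {S : Finset V} (hS : S ≠ Finset.univ) :
    ∫⁻ r, ENNReal.ofReal (φ (stoppedStep E β S r)) ∂ringLaw V =
      ENNReal.ofReal (heatOp E β φ S) := by
  have hpE : IsProbabilityMeasure (expMeasure (Fintype.card V)) :=
    isProbabilityMeasure_expMeasure (card_pos_real V)
  have hpU : IsProbabilityMeasure (uniformOn (Set.univ : Set V)) :=
    isProbabilityMeasure_uniformOn Set.finite_univ Set.univ_nonempty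
  have hm : Measurable fun r : Ring V => ENNReal.ofReal (φ (stoppedStep E β S r)) :=
    (Measurable.of_discrete (f := fun S => ENNReal.ofReal (φ S))).comp
      ((measurable_stoppedStep E β).comp measurable_prodMk_left)
  have hstep : ∀ (w : ℝ) (i : V) (u : unitInterval),
      ENNReal.ofReal (φ (stoppedStep E β S (w, i, u))) = if (u : ℝ) ≤ joinProb E β S i then
        ENNReal.ofReal (φ (insert i S)) else ENNReal.ofReal (φ (S.erase i)) := by
    intro w i u
    simp only [stoppedStep, if_neg hS]
    split_ifs <;> rfl
  have hw : ∀ w : ℝ, ∫⁻ p : V × unitInterval, ENNReal.ofReal (φ (stoppedStep E β S (w, p)))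
      ∂((uniformOn (Set.univ : Set V)).prod volume) = ENNReal.ofReal (heatOp E β φ S) := by
    intro w
    have hmw : Measurable fun p : V × unitInterval =>
        ENNReal.ofReal (φ (stoppedStep E β S (w, p))) := hm.comp measurable_prodMk_left
    rw [lintegral_prod _ hmw.aemeasurable, lintegral_fintype]
    simp only [hstep, lintegral_ite_le (joinProb_pos E β S _).le (joinProb_le_one E β S _)]
    have h1 : ∀ i, uniformOn (Set.univ : Set V) {i} = ENNReal.ofReal (Fintype.card V : ℝ)⁻¹ := by
      intro i
      rw [uniformOn_univ, Measure.count_singleton, one_div,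
        ENNReal.ofReal_inv_of_pos (card_pos_real V), ENNReal.ofReal_natCast]
    have h2 : ∀ i, ENNReal.ofReal (joinProb E β S i) * ENNReal.ofReal (φ (insert i S)) +
        ENNReal.ofReal (1 - joinProb E β S i) * ENNReal.ofReal (φ (S.erase i)) =
        ENNReal.ofReal (siteMean E β φ S i) := by
      intro i
      have h3 := (joinProb_pos E β S i).le
      have h4 := sub_nonneg.2 (joinProb_le_one E β S i)
      rw [← ENNReal.ofReal_mul h3, ← ENNReal.ofReal_mul h4,
        ← ENNReal.ofReal_add (mul_nonneg h3 (hφ _)) (mul_nonneg h4 (hφ _))]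
      rfl
    have h5 : ∀ i, 0 ≤ siteMean E β φ S i := fun i =>
      (siteMean_const E β 0 S i).symm.trans_le (siteMean_mono hφ S i)
    simp only [h1, h2]
    rw [← Finset.sum_mul, ← ENNReal.ofReal_sum_of_nonneg fun i _ => h5 i,
      ← ENNReal.ofReal_mul (Finset.sum_nonneg fun i _ => h5 i), heatOp, div_eq_mul_inv]
  rw [ringLaw, lintegral_prod _ hm.aemeasurable]
  simp only [hw]
  simp

/-- The Markov property lets `hitProb` with remaining budget `k` be averaged over the position after
`m` rings; at `k = 0` it is the indicator of the full set. -/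
theorem clockLaw_drive_eq_univ (E : Finset V → ℝ) (β : ℝ) (S : Finset V) (m : ℕ) :
    clockLaw V {ω | drive (stoppedStep E β) S ω m = Finset.univ} =
      ENNReal.ofReal (hitProb E β m S) := by
  have hmeas := measurable_drive (measurable_stoppedStep E β) S
  have key : ∀ m k, ∫⁻ ω, ENNReal.ofReal (hitProb E β k (drive (stoppedStep E β) S ω m))
      ∂clockLaw V = ENNReal.ofReal (hitProb E β (k + m) S) := by
    intro m
    induction m with
    | zero => intro k; simp [drive]
    | succ m ih =>
      intro k
      rw [show k + (m + 1) = (k + 1) + m by ring, ← ih (k + 1), clockLaw,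
        lintegral_drive_succ (ringLaw V) (measurable_stoppedStep E β) S m
          (f := fun S => ENNReal.ofReal (hitProb E β k S)) Measurable.of_discrete]
      refine lintegral_congr fun ω => ?_
      by_cases hu : drive (stoppedStep E β) S ω m = Finset.univ
      · have h1 : ∀ j, hitProb E β j Finset.univ = 1 := fun j => by cases j <;> simp [hitProb]
        simp [hu, stoppedStep, h1]
      · rw [lintegral_ringLaw E β (hitProb_nonneg E β k) hu, hitProb, if_neg hu]
  have h0 := key m 0
  rw [zero_add] at h0
  rw [← h0]
  have hset : MeasurableSet {ω : ℕ → Ring V | drive (stoppedStep E β) S ω m = Finset.univ} :=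
    hmeas m (measurableSet_singleton (Finset.univ : Finset V))
  rw [← lintegral_indicator_one hset]
  refine lintegral_congr fun ω => ?_
  by_cases hu : drive (stoppedStep E β) S ω m = Finset.univ <;>
    simp [Set.indicator, hitProb, hu]

end StoppedChain

/-! ### From ring counts to the continuous hitting time -/

section HittingTime

variable {V : Type*} [Fintype V]

theorem strictMono_ringTime {V : Type*} {ω : ℕ → Ring V} (hω : ∀ k, 0 < (ω k).1) :
    StrictMono (ringTime ω) := by
  refine strictMono_nat_of_lt_succ fun m => ?_
  rw [ringTime, ringTime, Finset.sum_range_succ]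
  linarith [hω m]

theorem ringCount_ringTime {V : Type*} {ω : ℕ → Ring V} (hω : ∀ k, 0 < (ω k).1) (m : ℕ) :
    ringCount ω (ringTime ω m) = m := by
  have : {k : ℕ | ringTime ω (k + 1) ≤ ringTime ω m} = (Finset.range m : Set ℕ) := by
    ext k
    rw [Set.mem_ofPred_eq, (strictMono_ringTime hω).le_iff_le]
    simp
  rw [ringCount, this, Set.ncard_coe_finset, Finset.card_range]

theorem hittingTime_le {G : SimpleGraph V} {h : V → ℝ} {β : ℝ} {x : V → ℤˣ} {ω : ℕ → Ring V}
    (hω : ∀ k, 0 < (ω k).1) {k m : ℕ} (hkm : k ≤ m)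
    (hk : afterRings G h β x ω k = fun _ => 1) :
    hittingTime G h β x ω ≤ ENNReal.ofReal (ringTime ω m) := by
  have h0 : 0 ≤ ringTime ω k := Finset.sum_nonneg fun j _ => (hω j).le
  refine (iInf₂_le (ringTime ω k).toNNReal ?_).trans ?_
  · rw [process, Real.coe_toNNReal _ h0, ringCount_ringTime hω, hk]
  · exact ENNReal.ofReal_le_ofReal ((strictMono_ringTime hω).monotone hkm)

theorem hit_or_ringTime_lt {G : SimpleGraph V} {h : V → ℝ} {β : ℝ} {x : V → ℤˣ}
    {ω : ℕ → Ring V} (hω : ∀ k, 0 < (ω k).1) {t : ℝ≥0} (ht : hittingTime G h β x ω < t)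
    (m : ℕ) : (∃ k ≤ m, afterRings G h β x ω k = fun _ => 1) ∨ ringTime ω (m + 1) ≤ t := by
  obtain ⟨s, hs⟩ := iInf_lt_iff.1 ht
  obtain ⟨hproc, hst⟩ := iInf_lt_iff.1 hs
  -- No non-explosion argument is needed: `ncard` of an infinite set is `0`, so such an `ω` has the
  -- initial configuration at time `s` and falls into the first case.
  rcases le_or_gt (ringCount ω s) m with hle | hlt
  · exact Or.inl ⟨_, hle, hproc⟩
  · right
    have : ∃ k ∈ {k : ℕ | ringTime ω (k + 1) ≤ s}, m ≤ k := by
      by_contra! hcon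
      have hsub : {k : ℕ | ringTime ω (k + 1) ≤ s} ⊆ (Finset.range m : Set ℕ) := by
        intro k hk
        simpa using hcon k hk
      have := Set.ncard_le_ncard hsub (Finset.finite_toSet _)
      rw [Set.ncard_coe_finset, Finset.card_range] at this
      exact absurd hlt (not_lt.2 this)
    obtain ⟨k, hk, hmk⟩ := this
    refine ((strictMono_ringTime hω).monotone (Nat.succ_le_succ hmk)).trans (le_trans hk ?_)
    exact_mod_cast (ENNReal.coe_lt_coe.1 hst).le

variable [Nonempty V]

/-- Tail bound for the hitting time from the discrete chain. -/
theorem exists_probHittingGE_le (V : Type*) [Fintype V] [Nonempty V] : ∃ C : ℝ, 0 < C ∧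
    ∀ (G : SimpleGraph V) (h : V → ℝ) (β : ℝ) (x : V → ℤˣ) (m : ℕ) (t : ℝ≥0), 0 < t →
      probHittingGE G h β x t ≤
        ENNReal.ofReal (1 - hitProb (tiltedEnergy G h) β m (plusSet x)) +
          ENNReal.ofReal (C * m / t) := by
  let _ : MeasurableSpace V := ⊤
  obtain ⟨C, hC, hCb⟩ := exists_clockLaw_le_ringTime V
  refine ⟨C, hC, fun G h β x m t ht => ?_⟩
  set H := {ω : ℕ → Ring V |
    drive (stoppedStep (tiltedEnergy G h) β) (plusSet x) ω m = Finset.univ} with hH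
  have hHm : MeasurableSet H := measurable_drive (measurable_stoppedStep _ β) _ m
    (measurableSet_singleton (Finset.univ : Finset V))
  have hsub : {ω | (t : ℝ≥0∞) ≤ hittingTime G h β x ω} ≤ᵐ[clockLaw V]
      (Hᶜ ∪ {ω | (t : ℝ) ≤ ringTime ω m} : Set (ℕ → Ring V)) := by
    filter_upwards [ae_wait_pos (V := V)] with ω hω hωt
    by_cases hωH : ω ∈ H
    · right
      obtain ⟨k, hkm, hk⟩ := (drive_stoppedStep_eq_univ_iff G h β x ω m).1 hωH
      have h1 := le_trans hωt (hittingTime_le hω hkm hk)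
      have h0 : 0 ≤ ringTime ω m := Finset.sum_nonneg fun j _ => (hω j).le
      rw [← ENNReal.ofReal_coe_nnreal] at h1
      exact (ENNReal.ofReal_le_ofReal_iff h0).1 h1
    · exact Or.inl hωH
  refine (measure_mono_ae hsub).trans ((measure_union_le _ _).trans ?_)
  refine add_le_add (le_of_eq ?_) (hCb m t (by exact_mod_cast ht))
  rw [prob_compl_eq_one_sub hHm, hH, clockLaw_drive_eq_univ, ← ENNReal.ofReal_one,
    ← ENNReal.ofReal_sub _ (hitProb_nonneg _ β m _)]

/-- Hitting before `t` needs either a hit within `m` rings or an `(m + 1)`-st ring by time `t`; a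
union bound covers everything. -/
theorem one_le_probHittingGE_add (G : SimpleGraph V) (h : V → ℝ) (β : ℝ) (x : V → ℤˣ) (m : ℕ)
    (t : ℝ≥0) :
    let _ : MeasurableSpace V := ⊤
    1 ≤ probHittingGE G h β x t +
      (ENNReal.ofReal (hitProb (tiltedEnergy G h) β m (plusSet x)) +
        clockLaw V {ω | ringTime ω (m + 1) ≤ t}) := by
  let _ : MeasurableSpace V := ⊤
  rw [← clockLaw_drive_eq_univ, ← measure_univ (μ := clockLaw V)]
  refine le_trans (measure_mono_ae (t := {ω | (t : ℝ≥0∞) ≤ hittingTime G h β x ω} ∪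
    ({ω | drive (stoppedStep (tiltedEnergy G h) β) (plusSet x) ω m = Finset.univ} ∪
      {ω | ringTime ω (m + 1) ≤ t})) ?_) ((measure_union_le _ _).trans
        (add_le_add le_rfl (measure_union_le _ _)))
  filter_upwards [ae_wait_pos (V := V)] with ω hω _
  rcases le_or_gt (t : ℝ≥0∞) (hittingTime G h β x ω) with h1 | h1
  · exact Or.inl h1
  · right
    rcases hit_or_ringTime_lt hω h1 m with h2 | h2
    · exact Or.inl ((drive_stoppedStep_eq_univ_iff G h β x ω m).2 h2)
    · exact Or.inr h2

end HittingTime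

/-! ### Matching bounds for the typical hitting time -/

section TypicalHittingTime

open scoped Classical

variable {V : Type*} [Fintype V] [Nonempty V]

theorem exists_typicalHittingTime_le (G : SimpleGraph V) (h : V → ℝ) :
    ∃ c : ℝ, 0 < c ∧ ∀ β : ℝ, 0 ≤ β → typicalHittingTime G h β ≤
      ENNReal.ofReal (c * Real.exp (2 * β * maxTiltedCutwidth G h)) := by
  obtain ⟨C, hC, hCb⟩ := exists_probHittingGE_le V
  set K : ℝ := Fintype.card (Finset V) * (2 * (Fintype.card V : ℝ) ^ 3) with hK
  have hn := card_pos_real V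
  have hN : (0 : ℝ) < Fintype.card (Finset V) := by exact_mod_cast Fintype.card_pos
  have hK0 : 0 < K := by positivity
  -- With `m = ⌈8KB⌉` and `t = 8Cm`, the chain and the clocks each fail with probability at most `1
  -- / 8`, and `1 / 4 < exp (-1)`. The `+ 1` pays for the ceiling because `1 ≤ B`.
  refine ⟨8 * C * (8 * K + 1), by positivity, fun β hβ => iSup_le fun x => ?_⟩
  set B := Real.exp (2 * β * maxTiltedCutwidth G h) with hB
  have hB1 : 1 ≤ B := Real.one_le_exp (mul_nonneg (by linarith) (maxTiltedCutwidth_nonneg G h))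
  set m := ⌈8 * K * B⌉₊ with hm
  have hm1 : 8 * K * B ≤ m := Nat.le_ceil _
  have hm2 : (m : ℝ) < 8 * K * B + 1 := Nat.ceil_lt_add_one (by positivity)
  have hm0 : (0 : ℝ) < m := lt_of_lt_of_le (by positivity) hm1
  have ht0 : 0 < 8 * C * m := by positivity
  have hprob := hCb G h β x m (8 * C * m).toNNReal (by simpa using ht0)
  rw [Real.coe_toNNReal _ ht0.le] at hprob
  have h1 : 1 - hitProb (tiltedEnergy G h) β m (plusSet x) ≤ 1 / 8 := by
    have := mul_one_sub_hitProb_le hβ (climbs_univ G h) m (plusSet x)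
    refine le_of_mul_le_mul_left (this.trans ?_) hm0
    rw [← hB]
    linarith
  have h2 : C * m / (8 * C * m) = 1 / 8 := by field_simp
  have h3 : probHittingGE G h β x (8 * C * m).toNNReal ≤ ENNReal.ofReal (Real.exp (-1)) := by
    refine hprob.trans ?_
    rw [h2]
    refine (add_le_add_left (ENNReal.ofReal_le_ofReal h1) _).trans ?_
    rw [← ENNReal.ofReal_add (by norm_num) (by norm_num)]
    refine ENNReal.ofReal_le_ofReal ?_
    rw [Real.exp_neg, le_inv_comm₀ (by norm_num) (Real.exp_pos 1)]
    linarith [Real.exp_one_lt_d9]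
  refine (iInf₂_le (8 * C * m).toNNReal h3).trans (ENNReal.ofReal_le_ofReal ?_)
  nlinarith [mul_pos hC (by linarith : 0 < B)]

theorem clockLaw_ringTime_one_le [MeasurableSpace V] [MeasurableSingletonClass V] (t : ℝ≥0) :
    clockLaw V {ω | ringTime ω 1 ≤ t} ≤ ENNReal.ofReal (Fintype.card V * t) := by
  have h1 : {ω : ℕ → Ring V | ringTime ω 1 ≤ t} = (fun ω => (ω 0).1) ⁻¹' Set.Iic (t : ℝ) := by
    ext ω
    simp [ringTime]
  rw [h1, (measurePreserving_wait 0).measure_preimage measurableSet_Iic.nullMeasurableSet,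
    expMeasure_Iic (card_pos_real V) t.coe_nonneg]
  exact ENNReal.ofReal_le_ofReal (by
    linarith [Real.add_one_le_exp (-(Fintype.card V * (t : ℝ)))])

/-- If the chain is unlikely to hit within `m` updates and the clocks are unlikely to ring more
than `m` times up to time `t`, then the hitting time is not typically below `t`. -/
theorem lt_probHittingGE {G : SimpleGraph V} {h : V → ℝ} {β : ℝ} {x : V → ℤˣ} {m : ℕ} {t : ℝ≥0}
    {a b : ℝ} (ha : hitProb (tiltedEnergy G h) β m (plusSet x) ≤ a)
    (hb : letI : MeasurableSpace V := ⊤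
      clockLaw V {ω | ringTime ω (m + 1) ≤ t} ≤ ENNReal.ofReal b)
    (ha0 : 0 ≤ a) (hb0 : 0 ≤ b) (hab : a + b ≤ 1 / 2) :
    ENNReal.ofReal (Real.exp (-1)) < probHittingGE G h β x t := by
  by_contra! hcon
  have h1 := (one_le_probHittingGE_add G h β x m t).trans
    (add_le_add hcon (add_le_add (ENNReal.ofReal_le_ofReal ha) hb))
  rw [← ENNReal.ofReal_add ha0 hb0, ← ENNReal.ofReal_add (Real.exp_pos _).le (by linarith),
    ENNReal.one_le_ofReal] at h1
  have h2 : Real.exp (-1) < 1 / 2 := by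
    rw [Real.exp_neg, inv_lt_comm₀ (Real.exp_pos 1) (by norm_num)]
    linarith [Real.exp_one_gt_d9]
  linarith

theorem exists_le_typicalHittingTime (G : SimpleGraph V) (h : V → ℝ) :
    ∃ c : ℝ, 0 < c ∧ ∀ β : ℝ, 0 ≤ β →
      ENNReal.ofReal (c * Real.exp (2 * β * maxTiltedCut G h)) ≤ typicalHittingTime G h β := by
  obtain ⟨A, Ω, hΩ, hu, hA, hbar⟩ := exists_barrier G h
  have hAu : A ≠ Finset.univ := fun h => hu (h ▸ hA)
  let _ : MeasurableSpace V := ⊤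
  obtain ⟨ρ, hρ0, hρ1, hρ⟩ := exists_clockLaw_ringTime_le V
  set N : ℝ := (Fintype.card (Finset V) : ℝ) with hN
  set n : ℝ := (Fintype.card V : ℝ) with hn
  have hn0 : 0 < n := card_pos_real V
  have hN0 : 0 < N := by rw [hN]; exact_mod_cast Fintype.card_pos
  set l : ℝ := -Real.log ρ with hl
  have hl0 : 0 < l := neg_pos.2 (Real.log_neg hρ0 hρ1)
  set B₀ : ℝ := 8 * N * Real.log 4 / l with hB₀
  have hB₀0 : 0 < B₀ := by
    have := Real.log_pos (by norm_num : (1 : ℝ) < 4)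
    positivity
  -- The first constant serves `B₀ ≤ B`, the second `B < B₀`. The latter case can persist for all
  -- `β`: `B = 1` throughout when the maximal tilted cut is `0`.
  refine ⟨min (l / (8 * N)) (1 / (2 * n * B₀)), by positivity, fun β hβ => ?_⟩
  set B := Real.exp (2 * β * maxTiltedCut G h) with hB
  have hB0 : 0 < B := Real.exp_pos _
  set x : V → ℤˣ := fun i => if i ∈ A then 1 else -1 with hx
  have hxA : plusSet x = A := by
    have h1 : ¬ ((-1 : ℤˣ) = 1) := by decide
    ext i
    by_cases hi : i ∈ A <;> simp [mem_plusSet, hx, hi, h1]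
  refine le_iSup_of_le x (le_iInf₂ fun t ht => ?_)
  by_contra! hlt
  refine ht.not_gt ?_
  have htlt : (t : ℝ) < min (l / (8 * N)) (1 / (2 * n * B₀)) * B := by
    rwa [← ENNReal.ofReal_coe_nnreal, ENNReal.ofReal_lt_ofReal_iff (by positivity)] at hlt
  rcases le_or_gt B₀ B with hBB | hBB
  -- This `m` makes the hitting probability at most `m * N / B ≤ 1 / 4`. The clock bound has
  -- exponent at most `-(B * l / (8 * N))`, and `B₀` is chosen to make this at most `-log 4`.
  · set m := ⌊B / (4 * N)⌋₊ with hm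
    have hm1 : (m : ℝ) ≤ B / (4 * N) := Nat.floor_le (by positivity)
    have hm2 : B / (4 * N) < m + 1 := Nat.lt_floor_add_one _
    have hhit : hitProb (tiltedEnergy G h) β m (plusSet x) ≤ 1 / 4 := by
      rw [hxA]
      refine (hitProb_le (tiltedEnergy_submodular G h) hβ hΩ hu hA hbar m).trans ?_
      rw [Real.exp_neg, ← hB, ← hN]
      rw [le_div_iff₀ (by positivity)] at hm1
      rw [← div_eq_mul_inv, mul_div_assoc', div_le_iff₀ hB0]
      linarith
    refine lt_probHittingGE (b := 1 / 4) hhit ((hρ (m + 1) t).trans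
      (ENNReal.ofReal_le_ofReal ?_)) (by norm_num) (by norm_num) (by norm_num)
    have hρm : ρ ^ (m + 1) = Real.exp (-((m + 1 : ℕ) * l)) := by
      rw [hl, mul_neg, neg_neg, Real.exp_nat_mul, Real.exp_log hρ0]
    rw [hρm, ← Real.exp_add, ← Real.le_log_iff_exp_le (by norm_num)]
    have ht1 : (t : ℝ) ≤ l / (8 * N) * B :=
      htlt.le.trans (mul_le_mul_of_nonneg_right (min_le_left _ _) hB0.le)
    have h1 : B / (4 * N) * l ≤ ((m + 1 : ℕ) : ℝ) * l := by
      push_cast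
      exact mul_le_mul_of_nonneg_right hm2.le hl0.le
    have h2 : l / (8 * N) * B - B / (4 * N) * l = -(B * (l / (8 * N))) := by
      field_simp
      ring
    have h3 : Real.log 4 ≤ B * (l / (8 * N)) := by
      rw [hB₀, div_le_iff₀ hl0] at hBB
      rw [mul_div_assoc', le_div_iff₀ (by positivity)]
      linarith
    have h4 : Real.log (1 / 4) = -Real.log 4 := by rw [one_div, Real.log_inv]
    rw [h4]
    linarith
  -- For bounded `B` it suffices that no clock has rung: the start `A` is not the full set, and the
  -- first ring comes by time `1 / (2n)` with probability at most `1 / 2`.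
  · have hhit : hitProb (tiltedEnergy G h) β 0 (plusSet x) ≤ 0 := by
      rw [hxA, hitProb, if_neg hAu]
    refine lt_probHittingGE (b := 1 / 2) hhit ((clockLaw_ringTime_one_le t).trans
      (ENNReal.ofReal_le_ofReal ?_)) le_rfl (by norm_num) (by norm_num)
    have ht1 : (t : ℝ) ≤ 1 / (2 * n * B₀) * B :=
      htlt.le.trans (mul_le_mul_of_nonneg_right (min_le_right _ _) hB0.le)
    have ht2 : 1 / (2 * n * B₀) * B ≤ 1 / (2 * n) := by
      rw [div_mul_eq_mul_div, one_mul, div_le_div_iff₀ (by positivity) (by positivity)]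
      nlinarith
    have ht3 : (t : ℝ) ≤ 1 / (2 * n) := ht1.trans ht2
    rw [le_div_iff₀ (by positivity)] at ht3
    linarith

end TypicalHittingTime

/-- A quantity that agrees with `exp (a * β)` up to constant factors is `exp (a * β + o(β))`. -/
theorem exists_isLittleO_of_bounds {τ : ℝ → ℝ≥0∞} {a c₁ c₂ : ℝ} (hc₁ : 0 < c₁) (hc₂ : 0 < c₂)
    (h₁ : ∀ β, 0 ≤ β → ENNReal.ofReal (c₁ * Real.exp (2 * β * a)) ≤ τ β)
    (h₂ : ∀ β, 0 ≤ β → τ β ≤ ENNReal.ofReal (c₂ * Real.exp (2 * β * a))) :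
    ∃ g : ℝ → ℝ, Asymptotics.IsLittleO atTop g (fun β : ℝ => β) ∧
      ∀ᶠ β : ℝ in atTop, τ β = ENNReal.ofReal (Real.exp (2 * β * a + g β)) := by
  have hlow : ∀ β, 0 ≤ β → c₁ * Real.exp (2 * β * a) ≤ (τ β).toReal := fun β hβ =>
    (ENNReal.ofReal_le_iff_le_toReal (ne_top_of_le_ne_top ENNReal.ofReal_ne_top (h₂ β hβ))).1
      (h₁ β hβ)
  have hup : ∀ β, 0 ≤ β → (τ β).toReal ≤ c₂ * Real.exp (2 * β * a) := fun β hβ =>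
    ENNReal.toReal_le_of_le_ofReal (by positivity) (h₂ β hβ)
  have hpos : ∀ β, 0 ≤ β → 0 < (τ β).toReal := fun β hβ =>
    lt_of_lt_of_le (by positivity) (hlow β hβ)
  refine ⟨fun β => Real.log (τ β).toReal - 2 * β * a, ?_, ?_⟩
  · refine Asymptotics.IsBigO.trans_isLittleO (g := fun _ : ℝ => (1 : ℝ)) ?_
      (Asymptotics.isLittleO_const_id_atTop 1)
    refine Asymptotics.IsBigO.of_bound (max |Real.log c₁| |Real.log c₂|) ?_
    filter_upwards [eventually_ge_atTop 0] with β hβ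
    have e1 := Real.log_le_log (by positivity) (hlow β hβ)
    have e2 := Real.log_le_log (hpos β hβ) (hup β hβ)
    rw [Real.log_mul hc₁.ne' (Real.exp_pos _).ne', Real.log_exp] at e1
    rw [Real.log_mul hc₂.ne' (Real.exp_pos _).ne', Real.log_exp] at e2
    rw [norm_one, mul_one, Real.norm_eq_abs]
    exact abs_le_max_abs_abs (by linarith) (by linarith)
  · filter_upwards [eventually_ge_atTop 0] with β hβ
    rw [add_sub_cancel, Real.exp_log (hpos β hβ), ENNReal.ofReal_toReal
      (ne_top_of_le_ne_top ENNReal.ofReal_ne_top (h₂ β hβ))]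

end Glauber

end

theorem theorem1 {V : Type*} [Fintype V] [Nonempty V] (G : SimpleGraph V) (h : V → ℝ)
    (hh : ∀ i, 0 ≤ h i) :
    (∃ g : ℝ → ℝ, Asymptotics.IsLittleO atTop g (fun β : ℝ => β) ∧
      ∀ᶠ β : ℝ in atTop, Glauber.typicalHittingTime G h β =
        ENNReal.ofReal (Real.exp (2 * β * Glauber.maxTiltedCutwidth G h + g β))) ∧
    Glauber.maxTiltedCutwidth G h = Glauber.maxTiltedCut G h := by
  have heq := Glauber.maxTiltedCutwidth_eq_maxTiltedCut G h
  obtain ⟨c₁, hc₁, h₁⟩ := Glauber.exists_le_typicalHittingTime G h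
  obtain ⟨c₂, hc₂, h₂⟩ := Glauber.exists_typicalHittingTime_le G h
  rw [← heq] at h₁
  exact ⟨Glauber.exists_isLittleO_of_bounds hc₁ hc₂ h₁ h₂, heq⟩
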